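/- Notation. For $n\in\mathbb N$ and real $\alpha,\beta$ let $$P_n^{(\alpha,\beta)}(z)=2^{-n}\sum_{k=0}^n\binom{n+\alpha}{n-k}\binom{n+\beta}{k}(z-1)^k(z+1)^{n-k}$$ be the Jacobi polynomial. Let $[c]$ be the largest integer $\le c$. Let $\mathbb P_m$ be the set of complex polynomials of degree $\le m$ (only the zero polynomial if $m<0$), and $\mathbb P_m^*$ the set of polynomials of degree exactly $m$ (so $0\notin\mathbb P_m^*$). Contours. All curves are continuous and piecewise $C^1$. $\Gamma_1$ is any curve from $1$ to $1$ that lies in $\mathbb C\setminus[-1,+\infty)$ except for its endpoints, starts in the lower half plane and ends in the upper half plane (from $1-i0$ to $1+i0$). $\Gamma_{-1}$ is any curve from $-1$ to $-1$ that lies in $\mathbb C\setminus(-\infty,1]$ except for its endpoints, starts in the upper half plane and ends in the lower half plane (from $-1+i0$ to $-1-i0$). $\Gamma_\infty$ is any curve in $\mathbb C\setminus((-\infty,-1]\cup[1,+\infty))$ that comes from infinity in the upper half plane and goes to infinity in the lower half plane (from $+i\infty$ to $-i\infty$). The curves are assumed to be tame at their ends: for $s=\pm1$ the function $|t-s|^c$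 is integrable with respect to arc length on $\Gamma_s$ for every $c>-1$, and $(1+|t|)^c$ is integrable with respect to arc length on $\Gamma_\infty$ for every $c<-1$. (For $\Gamma_{\pm1}$ this holds, for instance, if the curve has finite length and is $C^1$ up to its two ends with nonzero one-sided derivatives there.) In each integral below, $w(t;a,b)$ denotes an arbitrary branch of $(1-t)^a(t+1)^b=\exp[a\log(1-t)+b\log(t+1)]$ that is continuous along the curve of integration, without its endpoints. "$\int=0$" and "$\int\neq0$" include the assertion that the integral converges absolutely. Theorem. Let $\alpha,\beta,\alpha+\beta\in\mathbb R\setminus\mathbb Z$ with $\alpha<-1$, $\beta<-1$ and $2n+\alpha+\beta>0$. Put $P=P_n^{(\alpha,\beta)}$; it has degree $n$. (i) If $\alpha+\beta+n>-1$, then $$\int_{\Gamma_{-1}}q(t)P(t)\,w(t;\alpha,\beta+[-\beta])\,dt=0,\quad q\in\mathbb P_{[-\alpha]-1},$$ $$\int_{\Gamma_{1}}q(t)P(t)\,w(t;\alpha+[-\alpha],\beta)\,dt=0,\quad q\in\mathbb P_{[-\beta]-1},$$ $$\int_{-1}^1q(t)P(t)\,w(t;\alpha+[-\alpha],\beta+[-\beta])\,dt\begin{cases}=0,&q\in\mathbb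 P_{n-[-\alpha]-[-\beta]-1},\\ \neq0,&q\in\mathbb P^*_{n-[-\alpha]-[-\beta]}.\end{cases}$$ (ii) If $\alpha<-n$, then $$\int_{-\infty}^{-1}q(t)P(t)\,w(t;\alpha,\beta+[-\beta])\,dt=0,\quad q\in\mathbb P_{[-\alpha]-n-1},$$ $$\int_{\Gamma_\infty}q(t)P(t)\,w(t;\alpha,\beta)\,dt=0,\quad q\in\mathbb P_{[-\beta]-1},$$ $$\int_{\Gamma_{-1}}q(t)P(t)\,t^{-n+[-\alpha]}w(t;\alpha,\beta+[-\beta])\,dt\begin{cases}=0,&q\in\mathbb P_{2n-[-\alpha]-[-\beta]-1},\\ \neq0,&q\in\mathbb P^*_{2n-[-\alpha]-[-\beta]}.\end{cases}$$ (iii) If $\beta<-n$, then $$\int_{1}^{+\infty}q(t)P(t)\,w(t;\alpha+[-\alpha],\beta)\,dt=0,\quad q\in\mathbb P_{[-\beta]-n-1},$$ $$\int_{\Gamma_\infty}q(t)P(t)\,w(t;\alpha,\beta)\,dt=0,\quad q\in\mathbb P_{[-\alpha]-1},$$ $$\int_{\Gamma_{1}}q(t)P(t)\,t^{-n+[-\beta]}w(t;\alpha+[-\alpha],\beta)\,dt\begin{cases}=0,&q\in\mathbb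 P_{2n-[-\alpha]-[-\beta]-1},\\ \neq0,&q\in\mathbb P^*_{2n-[-\alpha]-[-\beta]}.\end{cases}$$ In each of the three cases the orthogonality conditions characterize $P$ up to a constant factor: for any choice of the contours and branches, a polynomial $p$ of degree $\le n$ satisfies the three families of conditions "$\int=0$" (with $P$ replaced by $p$) if and only if $p=cP$ for some $c\in\mathbb C$. -/

import Mathlib

open Set Filter Topology MeasureTheory Polynomial

noncomputable section

/-- The Jacobi polynomial
`P_n^{(α,β)}(z) = 2^{-n} ∑_{k=0}^n binom(n+α, n-k) binom(n+β, k) (z-1)^k (z+1)^{n-k}`,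
with generalized binomial coefficients, as a polynomial with complex coefficients. -/
def jacobiP (n : ℕ) (α β : ℝ) : ℂ[X] :=
  C ((2 : ℂ)⁻¹ ^ n) * ∑ k ∈ Finset.range (n + 1),
    C ((Ring.choose ((n : ℝ) + α) (n - k) * Ring.choose ((n : ℝ) + β) k : ℝ) : ℂ) *
      ((X - 1) ^ k * (X + 1) ^ (n - k))

/-- Complex polynomials of degree at most `m`; for `m < 0` only the zero polynomial. -/
def polyDegLE (m : ℤ) : Set ℂ[X] := {q | q = 0 ∨ (q.natDegree : ℤ) ≤ m}

/-- Complex polynomials of degree exactly `m` (in particular not zero). -/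
def polyDegEq (m : ℤ) : Set ℂ[X] := {q | q ≠ 0 ∧ (q.natDegree : ℤ) = m}

/-- All the values at `z` of the multi-valued function
`(1 - z)^α (z + 1)^β = exp (α log (1 - z) + β log (z + 1))`. -/
def weightValues (α β : ℝ) (z : ℂ) : Set ℂ :=
  {v | ∃ l₁ l₂ : ℂ, Complex.exp l₁ = 1 - z ∧ Complex.exp l₂ = z + 1 ∧
    v = Complex.exp (α * l₁ + β * l₂)}

/-- `W` is a continuous branch of the weight `(1 - t)^α (t + 1)^β` along the curve `t = γ s`,
`s ∈ I`. -/
def IsWeightBranch (α β : ℝ) (I : Set ℝ) (γ W : ℝ → ℂ) : Prop :=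
  ContinuousOn W I ∧ ∀ s ∈ I, W s ∈ weightValues α β (γ s)

/-- Off finitely many parameter values, `γ` is continuously differentiable on `I`. -/
def IsPiecewiseC1 (I : Set ℝ) (γ : ℝ → ℂ) : Prop :=
  ContinuousOn γ I ∧ ∃ S : Finset ℝ, ∀ s ∈ I, s ∉ S → ContDiffAt ℝ 1 γ s

/-- A closed piecewise `C¹` curve `γ : [0,1] → ℂ` based at `a`, along which every power
`|t - a|^c` with `c > -1` is integrable with respect to arc length. (The last condition holds
for instance when the curve has finite length and is `C¹` up to its two ends with nonzero
one-sided derivatives there; for `c = 0` it says that the length is finite.) -/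
structure IsContourAt (a : ℂ) (γ : ℝ → ℂ) : Prop where
  start_eq : γ 0 = a
  end_eq : γ 1 = a
  piecewiseC1 : IsPiecewiseC1 (Ioo 0 1) γ
  continuousOn : ContinuousOn γ (Icc 0 1)
  integrable_pow : ∀ c : ℝ, -1 < c →
    IntegrableOn (fun s => ‖γ s - a‖ ^ c * ‖deriv γ s‖) (Ioo 0 1)

/-- The contours `Γ₁`: from `1 - i0` to `1 + i0` in `ℂ \ [-1, +∞)`. -/
structure IsGammaOne (γ : ℝ → ℂ) : Prop where
  contour : IsContourAt 1 γ
  avoids : ∀ s ∈ Ioo (0 : ℝ) 1, γ s ∉ ((↑) : ℝ → ℂ) '' Ici (-1)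
  start_side : ∀ᶠ s in 𝓝[>] (0 : ℝ), (γ s).im < 0
  end_side : ∀ᶠ s in 𝓝[<] (1 : ℝ), 0 < (γ s).im

/-- The contours `Γ₋₁`: from `-1 + i0` to `-1 - i0` in `ℂ \ (-∞, 1]`. -/
structure IsGammaNegOne (γ : ℝ → ℂ) : Prop where
  contour : IsContourAt (-1) γ
  avoids : ∀ s ∈ Ioo (0 : ℝ) 1, γ s ∉ ((↑) : ℝ → ℂ) '' Iic 1
  start_side : ∀ᶠ s in 𝓝[>] (0 : ℝ), 0 < (γ s).im
  end_side : ∀ᶠ s in 𝓝[<] (1 : ℝ), (γ s).im < 0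

/-- The contours `Γ_∞`: piecewise `C¹` curves `γ : ℝ → ℂ` in `ℂ \ ((-∞, -1] ∪ [1, +∞))` that
come from infinity in the upper half plane and go to infinity in the lower half plane, along
which every power `(1 + |t|)^c` with `c < -1` is integrable with respect to arc length. -/
structure IsGammaInfty (γ : ℝ → ℂ) : Prop where
  piecewiseC1 : IsPiecewiseC1 univ γ
  avoids : ∀ s : ℝ, γ s ∉ ((↑) : ℝ → ℂ) '' (Iic (-1) ∪ Ici 1)
  tendsto_start : Tendsto γ atBot (Bornology.cobounded ℂ)
  start_side : ∀ᶠ s in atBot, 0 < (γ s).im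
  tendsto_end : Tendsto γ atTop (Bornology.cobounded ℂ)
  end_side : ∀ᶠ s in atTop, (γ s).im < 0
  integrable_pow : ∀ c : ℝ, c < -1 → Integrable (fun s => (1 + ‖γ s‖) ^ c * ‖deriv γ s‖)

/-- The integral of `f` along the curve `t = γ s`, `s ∈ I`, converges absolutely and has the
value `v`; `f` is given as a function of the parameter. -/
def HasContourIntegral (I : Set ℝ) (γ f : ℝ → ℂ) (v : ℂ) : Prop :=
  IntegrableOn (fun s => f s * deriv γ s) I ∧ ∫ s in I, f s * deriv γ s = v

/-- `∫ q(t) p(t) W dt = 0` along `t = γ s`, `s ∈ I`, for all polynomials `q` of degree at most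
`m`. -/
def OrthTo (I : Set ℝ) (γ W : ℝ → ℂ) (p : ℂ[X]) (m : ℤ) : Prop :=
  ∀ q ∈ polyDegLE m,
    HasContourIntegral I γ (fun s => q.eval (γ s) * p.eval (γ s) * W s) 0

/-- `∫ q(t) p(t) W dt ≠ 0` along `t = γ s`, `s ∈ I`, for all polynomials `q` of degree exactly
`m`. -/
def NonzeroAgainst (I : Set ℝ) (γ W : ℝ → ℂ) (p : ℂ[X]) (m : ℤ) : Prop :=
  ∀ q ∈ polyDegEq m, ∃ v : ℂ, v ≠ 0 ∧
    HasContourIntegral I γ (fun s => q.eval (γ s) * p.eval (γ s) * W s) v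

/-- Up to a constant factor, `P` is the only polynomial of degree at most `n` with the property
`conds`; `P` itself has degree `n`. -/
def CharacterizesUpToConst (n : ℕ) (P : ℂ[X]) (conds : ℂ[X] → Prop) : Prop :=
  P ≠ 0 ∧ P.natDegree = n ∧
    ∀ p : ℂ[X], (p.natDegree ≤ n ∧ conds p) ↔ ∃ c : ℂ, p = C c * P

end

noncomputable section

/-! Every integral in the theorem is, up to a nonzero factor, a value of one linear functional L =
`jacobiFunctional α β` on polynomials. L annihilates the range of `pearsonOp`, the operator f ↦
w⁻¹((1 - t²) w f)', and this property determines it up to a scalar, since the values on the powers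
of 1 + X then satisfy a two-term recurrence (`linearMap_eq_smul_jacobiFunctional`). Integration by
parts without boundary terms shows that integration against a branch of w is a multiple of L on the
polynomials for which it converges (`IsExhausted.hasContourIntegral`). Multiplying by a power of 1 +
X or 1 - X only shifts β or α and rescales the functional, so the differently shifted weights all
lead back to the same L.

The multiples must be nonzero, so the weight itself must have nonzero integral. On a real interval
it has constant phase. On a contour, an integer shift of the exponents and an affine or Möbius
substitution lead to ∫ v^A (1 + v)^B dv from -1 + i0 to -1 - i0 with A, B > 0. A primitive takes two
end values that differ by the phases exp(±πi(A + 1)) of one positive beta integral, and these are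
distinct because A is not an integer (`IsExhausted.integral_cpow_ne_zero`).

Orthogonality with respect to L comes from the Rodrigues relation `pearsonOp_jacobiP`: iterating it
gives L(P Q) = c L'(Q⁽ⁿ⁾), c ≠ 0, with L' the functional for α + n and β + n. Hence L(P Q) vanishes
for deg Q < n, does not vanish for deg Q = n, and P is the only such polynomial up to a factor.

What remains is division with remainder. Put a = [-α], b = [-β]. In case (i) the three families test
p against (1 + X)^b q₁, (1 - X)^a q₂ and (1 + X)^b (1 - X)^a q₃, which by coprimality span all
polynomials of degree < n (`orthogonal_iff_of_coprime`). In case (ii) the test polynomials are (1 +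
X)^b q₁, q₂ and (1 + X)^b X^(a-n) q₃, which span by two successive divisions
(`orthogonal_iff_of_nested`). Case (iii) is the mirror image. -/

/-! ### The algebraic Jacobi functional and its shifts. -/

/-- The operator `f ↦ w⁻¹ d/dt ((1 - t²) w f)` for the weight `w = (1 - t)^α (1 + t)^β`. -/
def pearsonOp (α β : ℝ) (f : ℂ[X]) : ℂ[X] :=
  derivative ((1 - X ^ 2) * f) + (C (β : ℂ) * (1 - X) - C (α : ℂ) * (1 + X)) * f

/-- The normalized moments of the Jacobi weight with respect to the powers of `1 + t`. -/
def jacobiMoment (α β : ℝ) (k : ℕ) : ℂ :=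
  ∏ j ∈ Finset.range k, (2 * (β + 1 + j) / (α + β + 2 + j) : ℂ)

/-- The normalized Jacobi functional, the algebraic version of integration against
`(1 - t)^α (1 + t)^β`. -/
def jacobiFunctional (α β : ℝ) : ℂ[X] →ₗ[ℂ] ℂ :=
  (Polynomial.lsum fun k => LinearMap.mulRight ℂ (jacobiMoment α β k)) ∘ₗ taylor (-1)

/-- A real number that is not an integer. -/
def NotInt (x : ℝ) : Prop := ∀ k : ℤ, x ≠ k

lemma NotInt.add_intCast {x : ℝ} (h : NotInt x) (m : ℤ) : NotInt (x + m) := fun k hk =>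
  h (k - m) (by push_cast; linarith)

lemma NotInt.add_natCast {x : ℝ} (h : NotInt x) (m : ℕ) : NotInt (x + m) := by
  simpa using h.add_intCast m

lemma NotInt.add_one {x : ℝ} (h : NotInt x) : NotInt (x + 1) := by
  simpa using h.add_natCast 1

lemma NotInt.add_natCast_ne_zero {x : ℝ} (h : NotInt x) (m : ℕ) : (x : ℂ) + m ≠ 0 := by
  have := h.add_natCast m 0
  exact_mod_cast this

lemma jacobiMoment_zero (α β : ℝ) : jacobiMoment α β 0 = 1 := by simp [jacobiMoment]

lemma jacobiMoment_succ {α β : ℝ} (h : NotInt (α + β)) (k : ℕ) :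
    (k + 2 + α + β : ℂ) * jacobiMoment α β (k + 1) = 2 * (k + 1 + β) * jacobiMoment α β k := by
  have h1 : (α + β + 2 + k : ℂ) ≠ 0 := by
    have := h.add_natCast_ne_zero (2 + k)
    push_cast at this
    simpa [add_assoc] using this
  rw [jacobiMoment, Finset.prod_range_succ, ← jacobiMoment]
  field_simp
  ring

lemma jacobiFunctional_pow (α β : ℝ) (k : ℕ) :
    jacobiFunctional α β ((X + 1) ^ k) = jacobiMoment α β k := by
  have : taylor (-1 : ℂ) ((X + 1) ^ k) = monomial k 1 := by
    rw [taylor_apply]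
    simp [monomial_one_right_eq_X_pow]
  simp [jacobiFunctional, this]

lemma jacobiFunctional_one (α β : ℝ) : jacobiFunctional α β 1 = 1 := by
  simpa [jacobiMoment_zero] using jacobiFunctional_pow α β 0

lemma pearsonOp_add (α β : ℝ) (f g : ℂ[X]) :
    pearsonOp α β (f + g) = pearsonOp α β f + pearsonOp α β g := by
  simp only [pearsonOp, mul_add, derivative_add]; ring

lemma pearsonOp_C_mul (α β : ℝ) (c : ℂ) (f : ℂ[X]) :
    pearsonOp α β (C c * f) = C c * pearsonOp α β f := by
  have : (1 - X ^ 2) * (C c * f) = C c * ((1 - X ^ 2) * f) := by ring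
  rw [pearsonOp, this, derivative_C_mul, pearsonOp]; ring

lemma pearsonOp_zero (α β : ℝ) : pearsonOp α β 0 = 0 := by simp [pearsonOp]

lemma pearsonOp_sum {ι : Type*} (α β : ℝ) (s : Finset ι) (f : ι → ℂ[X]) :
    pearsonOp α β (∑ i ∈ s, f i) = ∑ i ∈ s, pearsonOp α β (f i) := by
  classical
  induction s using Finset.induction_on with
  | empty => simp [pearsonOp_zero]
  | insert a s ha ih => rw [Finset.sum_insert ha, Finset.sum_insert ha, pearsonOp_add, ih]

/-- Powers of X + 1 are the convenient basis because 1 - X² = 2(X + 1) - (X + 1)², which leaves only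
two terms. -/
lemma pearsonOp_pow (α β : ℝ) (k : ℕ) :
    pearsonOp α β ((X + 1) ^ k) =
      C (2 * (k + 1 + β) : ℂ) * (X + 1) ^ k - C (k + 2 + α + β : ℂ) * (X + 1) ^ (k + 1) := by
  have h : (1 - X ^ 2) * (X + 1 : ℂ[X]) ^ k = 2 * (X + 1) ^ (k + 1) - (X + 1) ^ (k + 2) := by
    ring
  rw [pearsonOp, h]
  simp only [derivative_sub, derivative_mul, derivative_pow, derivative_X,
    derivative_one, derivative_ofNat, map_add, map_mul, map_natCast, map_ofNat, Nat.cast_add,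
    Nat.cast_one, Nat.cast_ofNat, add_tsub_cancel_right, map_one]
  simp only [show k + 2 - 1 = k + 1 by omega]
  ring

lemma exists_sum_X_add_one_pow (Q : ℂ[X]) :
    Q = ∑ k ∈ Finset.range (Q.natDegree + 1), C ((taylor (-1) Q).coeff k) * (X + 1) ^ k := by
  have h := sum_taylor_eq Q (-1)
  rw [Polynomial.sum_over_range (h := by simp), natDegree_taylor] at h
  simpa using h.symm

lemma jacobiFunctional_pearsonOp {α β : ℝ} (h : NotInt (α + β)) (f : ℂ[X]) :
    jacobiFunctional α β (pearsonOp α β f) = 0 := by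
  rw [exists_sum_X_add_one_pow f, pearsonOp_sum, map_sum]
  refine Finset.sum_eq_zero fun k _ => ?_
  rw [pearsonOp_C_mul, pearsonOp_pow]
  simp only [← smul_eq_C_mul, map_smul, map_sub, jacobiFunctional_pow, smul_eq_mul]
  rw [jacobiMoment_succ h]; simp

/-- The cutoff N is needed because on unbounded curves only finitely many moments converge. -/
lemma eq_jacobiMoment_of_recurrence {α β : ℝ} (h : NotInt (α + β)) {N : ℕ} {μ : ℕ → ℂ}
    (hμ : ∀ k < N, (k + 2 + α + β : ℂ) * μ (k + 1) = 2 * (k + 1 + β) * μ k) :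
    ∀ k ≤ N, μ k = μ 0 * jacobiMoment α β k := by
  intro k
  induction k with
  | zero => simp [jacobiMoment_zero]
  | succ k ih =>
    intro hk
    have h1 : (k + 2 + α + β : ℂ) ≠ 0 := by
      have := h.add_natCast_ne_zero (k + 2)
      push_cast at this
      convert this using 1; ring
    apply mul_left_cancel₀ h1
    rw [hμ k (by omega), ih (by omega)]
    linear_combination (-μ 0) * jacobiMoment_succ h k

/-- Vanishing on the range of `pearsonOp` is the moment recurrence, whose leading factor is never 0
because α + β is not an integer; the value at 1 therefore fixes everything. -/
lemma linearMap_eq_smul_jacobiFunctional {α β : ℝ} (h : NotInt (α + β)) (Λ : ℂ[X] →ₗ[ℂ] ℂ)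
    (hΛ : ∀ f, Λ (pearsonOp α β f) = 0) (Q : ℂ[X]) : Λ Q = Λ 1 * jacobiFunctional α β Q := by
  have key : ∀ k, Λ ((X + 1) ^ k) = Λ 1 * jacobiMoment α β k := by
    intro k
    have := eq_jacobiMoment_of_recurrence h (N := k) (μ := fun k => Λ ((X + 1) ^ k)) (fun k _ => by
      have := hΛ ((X + 1) ^ k)
      rw [pearsonOp_pow] at this
      simp only [← smul_eq_C_mul, map_smul, map_sub, smul_eq_mul] at this
      exact (sub_eq_zero.mp this).symm) k le_rfl
    simpa using this
  rw [exists_sum_X_add_one_pow Q, map_sum, map_sum, Finset.mul_sum]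
  refine Finset.sum_congr rfl fun k _ => ?_
  simp only [← smul_eq_C_mul, map_smul, smul_eq_mul, key, jacobiFunctional_pow]; ring

lemma pearsonOp_comp_neg_X (α β : ℝ) (f : ℂ[X]) :
    (pearsonOp α β f).comp (-X) = -pearsonOp β α (f.comp (-X)) := by
  simp only [pearsonOp, derivative_mul, derivative_comp, add_comp, mul_comp, sub_comp,
    pow_comp, X_comp, one_comp, C_comp, derivative_neg, derivative_X, derivative_sub,
    derivative_one, derivative_X_pow]
  simp
  ring

/-- The reflection t ↦ -t exchanges the two Pearson operators up to sign, so uniqueness applies;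
both sides are 1 at the constant 1. -/
lemma jacobiFunctional_comp_neg_X {α β : ℝ} (h : NotInt (α + β)) (Q : ℂ[X]) :
    jacobiFunctional α β (Q.comp (-X)) = jacobiFunctional β α Q := by
  have := linearMap_eq_smul_jacobiFunctional (α := β) (β := α) (by rwa [add_comm])
    (jacobiFunctional α β ∘ₗ (aeval (R := ℂ) (-X : ℂ[X])).toLinearMap) (fun f => by
      have e : aeval (R := ℂ) (-X : ℂ[X]) (pearsonOp β α f) = (pearsonOp β α f).comp (-X) := rfl
      simp [e, pearsonOp_comp_neg_X, jacobiFunctional_pearsonOp h]) Q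
  have e : aeval (R := ℂ) (-X : ℂ[X]) Q = Q.comp (-X) := rfl
  simpa [jacobiFunctional_one, e] using this

/-- Multiplication by 1 + X intertwines the Pearson operators for β + 1 and β, so uniqueness applies
again. The constant is the first moment, nonzero because β is not an integer. -/
lemma jacobiFunctional_one_add_X_mul {α β : ℝ} (h : NotInt (α + β)) (hβ : NotInt β) :
    ∃ c : ℂ, c ≠ 0 ∧ ∀ Q,
      jacobiFunctional α β ((1 + X) * Q) = c * jacobiFunctional α (β + 1) Q := by
  refine ⟨jacobiFunctional α β (1 + X), ?_, fun Q => ?_⟩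
  · have := jacobiFunctional_pow α β 1
    rw [pow_one, add_comm] at this
    rw [this]
    have h1 := hβ.add_natCast_ne_zero 1
    have h2 := h.add_natCast_ne_zero 2
    push_cast at h1 h2
    simp [jacobiMoment, h1, h2]
  · have := linearMap_eq_smul_jacobiFunctional (α := α) (β := β + 1)
      (by rw [← add_assoc]; exact h.add_one)
      (jacobiFunctional α β ∘ₗ LinearMap.mulLeft ℂ (1 + X)) (fun f => by
        have : (1 + X) * pearsonOp α (β + 1) f = pearsonOp α β ((1 + X) * f) := by
          simp only [pearsonOp, derivative_mul, derivative_add, derivative_sub, derivative_one,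
            derivative_X, derivative_X_pow]
          simp; ring
        simp [this, jacobiFunctional_pearsonOp h]) Q
    simpa using this

lemma jacobiFunctional_one_sub_X_mul {α β : ℝ} (h : NotInt (α + β)) (hα : NotInt α) :
    ∃ c : ℂ, c ≠ 0 ∧ ∀ Q,
      jacobiFunctional α β ((1 - X) * Q) = c * jacobiFunctional (α + 1) β Q := by
  obtain ⟨c, hc, H⟩ := jacobiFunctional_one_add_X_mul (α := β) (β := α) (by rwa [add_comm]) hα
  refine ⟨c, hc, fun Q => ?_⟩
  have h1 := H (Q.comp (-X))
  rw [jacobiFunctional_comp_neg_X (by rw [← add_assoc, add_comm β]; exact h.add_one)] at h1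
  rw [← h1, ← jacobiFunctional_comp_neg_X (by rwa [add_comm])]
  simp [sub_eq_add_neg]

lemma jacobiFunctional_one_add_X_pow_mul {α β : ℝ} (h : NotInt (α + β)) (hβ : NotInt β) (k : ℕ) :
    ∃ c : ℂ, c ≠ 0 ∧ ∀ Q,
      jacobiFunctional α β ((1 + X) ^ k * Q) = c * jacobiFunctional α (β + k) Q := by
  induction k with
  | zero => exact ⟨1, one_ne_zero, fun Q => by simp⟩
  | succ k ih =>
    obtain ⟨c, hc, H⟩ := ih
    obtain ⟨d, hd, H'⟩ := jacobiFunctional_one_add_X_mul (α := α) (β := β + k)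
      (by rw [← add_assoc]; exact h.add_natCast k) (hβ.add_natCast k)
    refine ⟨c * d, mul_ne_zero hc hd, fun Q => ?_⟩
    rw [pow_succ, mul_assoc, H, H', mul_assoc]; push_cast; rw [add_assoc]

lemma jacobiFunctional_one_sub_X_pow_mul {α β : ℝ} (h : NotInt (α + β)) (hα : NotInt α) (k : ℕ) :
    ∃ c : ℂ, c ≠ 0 ∧ ∀ Q,
      jacobiFunctional α β ((1 - X) ^ k * Q) = c * jacobiFunctional (α + k) β Q := by
  obtain ⟨c, hc, H⟩ := jacobiFunctional_one_add_X_pow_mul (α := β) (β := α) (by rwa [add_comm]) hα k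
  refine ⟨c, hc, fun Q => ?_⟩
  have h1 := H (Q.comp (-X))
  rw [jacobiFunctional_comp_neg_X (by rw [← add_assoc, add_comm β]; exact h.add_natCast k)] at h1
  rw [← h1, ← jacobiFunctional_comp_neg_X (by rwa [add_comm])]
  simp [sub_eq_add_neg]

/-! ### Jacobi polynomials: Rodrigues relation, degree, orthogonality. -/

lemma sub_natCast_mul_choose (r : ℝ) (k : ℕ) :
    (r - k) * Ring.choose r k = (k + 1) * Ring.choose r (k + 1) := by
  have h1 := Ring.descPochhammer_eq_factorial_smul_choose r k
  have h2 := Ring.descPochhammer_eq_factorial_smul_choose r (k + 1)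
  rw [descPochhammer_succ_right, smeval_mul, h1] at h2
  have h3 : ((X - (k : ℤ[X])) : ℤ[X]).smeval r = r - k := by
    simp [smeval_sub, smeval_X, smeval_natCast]
  rw [h3, Nat.factorial_succ, nsmul_eq_mul, nsmul_eq_mul] at h2
  have h4 : (k.factorial : ℝ) ≠ 0 := by positivity
  apply mul_left_cancel₀ h4
  push_cast at h2
  linarith

/-- The Rodrigues-type relation for Jacobi polynomials. -/
lemma pearsonOp_jacobiP (n : ℕ) (α β : ℝ) :
    pearsonOp α β (jacobiP n (α + 1) (β + 1)) =
      C (-2 * (n + 1) : ℂ) * jacobiP (n + 1) α β := by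
  have hT : ∀ k m : ℕ, pearsonOp α β ((X - 1) ^ k * (X + 1) ^ m) =
      -(C (k + 1 + α : ℂ) * ((X - 1) ^ k * (X + 1) ^ (m + 1)) +
        C (m + 1 + β : ℂ) * ((X - 1) ^ (k + 1) * (X + 1) ^ m)) := by
    intro k m
    have : (1 - X ^ 2) * ((X - 1) ^ k * (X + 1 : ℂ[X]) ^ m) =
        -((X - 1) ^ (k + 1) * (X + 1) ^ (m + 1)) := by ring
    rw [pearsonOp, this]
    simp only [derivative_neg, derivative_mul, derivative_pow, derivative_sub,
      derivative_X, derivative_one, map_add, map_natCast, Nat.cast_add, Nat.cast_one,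
      add_tsub_cancel_right, map_one]
    ring
  rw [jacobiP, jacobiP, pearsonOp_C_mul, pearsonOp_sum]
  have e1 : ∀ k ∈ Finset.range (n + 1),
      pearsonOp α β (C ((Ring.choose ((n : ℝ) + (α + 1)) (n - k) *
        Ring.choose ((n : ℝ) + (β + 1)) k : ℝ) : ℂ) * ((X - 1) ^ k * (X + 1) ^ (n - k))) =
      C (-((n + 1 - k : ℝ) * (Ring.choose (((n + 1 : ℕ) : ℝ) + α) (n + 1 - k) *
        Ring.choose (((n + 1 : ℕ) : ℝ) + β) k) : ℝ) : ℂ) * ((X - 1) ^ k * (X + 1) ^ (n + 1 - k)) +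
      C (-((k + 1 : ℝ) * (Ring.choose (((n + 1 : ℕ) : ℝ) + α) (n + 1 - (k + 1)) *
        Ring.choose (((n + 1 : ℕ) : ℝ) + β) (k + 1)) : ℝ) : ℂ) *
          ((X - 1) ^ (k + 1) * (X + 1) ^ (n + 1 - (k + 1))) := by
    intro k hk
    obtain ⟨m, rfl⟩ := Nat.exists_eq_add_of_le (Nat.lt_succ_iff.mp (Finset.mem_range.mp hk))
    have s1 : k + m - k = m := by omega
    have s2 : k + m + 1 - k = m + 1 := by omega
    have s3 : k + m + 1 - (k + 1) = m := by omega
    rw [pearsonOp_C_mul, s1, s2, s3, hT]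
    have a1 := sub_natCast_mul_choose (((k + m + 1 : ℕ) : ℝ) + α) m
    have a2 := sub_natCast_mul_choose (((k + m + 1 : ℕ) : ℝ) + β) k
    have t1 : ((k + m : ℕ) : ℝ) + (α + 1) = ((k + m + 1 : ℕ) : ℝ) + α := by push_cast; ring
    have t2 : ((k + m : ℕ) : ℝ) + (β + 1) = ((k + m + 1 : ℕ) : ℝ) + β := by push_cast; ring
    rw [t1, t2]
    set c1 := Ring.choose (((k + m + 1 : ℕ) : ℝ) + α) m
    set c2 := Ring.choose (((k + m + 1 : ℕ) : ℝ) + β) k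
    have b1 : ((((k + m : ℕ) : ℝ) + 1 - k) * (Ring.choose (((k + m + 1 : ℕ) : ℝ) + α) (m + 1) * c2))
        = (k + 1 + α) * (c1 * c2) := by
      push_cast at a1 ⊢
      linear_combination (-c2) * a1
    have b2 : (((k : ℝ) + 1) * (c1 * Ring.choose (((k + m + 1 : ℕ) : ℝ) + β) (k + 1)))
        = (m + 1 + β) * (c1 * c2) := by
      push_cast at a2 ⊢
      linear_combination (-c1) * a2
    rw [b1, b2]
    push_cast
    simp only [map_mul, map_neg, map_add, map_one, map_natCast]
    ring
  rw [Finset.sum_congr rfl e1, Finset.sum_add_distrib]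
  set g : ℕ → ℂ[X] := fun k => C ((Ring.choose (((n + 1 : ℕ) : ℝ) + α) (n + 1 - k) *
        Ring.choose (((n + 1 : ℕ) : ℝ) + β) k : ℝ) : ℂ) * ((X - 1) ^ k * (X + 1) ^ (n + 1 - k))
    with hg
  have f1 : ∀ k : ℕ, C (-((n + 1 - k : ℝ) * (Ring.choose (((n + 1 : ℕ) : ℝ) + α) (n + 1 - k) *
        Ring.choose (((n + 1 : ℕ) : ℝ) + β) k) : ℝ) : ℂ) * ((X - 1) ^ k * (X + 1) ^ (n + 1 - k))
      = -(C (n + 1 - k : ℂ) * g k) := by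
    intro k
    simp only [hg]; push_cast
    simp only [map_mul, map_neg, map_add, map_one, map_natCast, map_sub]; ring
  have f2 : ∀ k : ℕ, C (-((k + 1 : ℝ) * (Ring.choose (((n + 1 : ℕ) : ℝ) + α) (n + 1 - (k + 1)) *
        Ring.choose (((n + 1 : ℕ) : ℝ) + β) (k + 1)) : ℝ) : ℂ) *
          ((X - 1) ^ (k + 1) * (X + 1) ^ (n + 1 - (k + 1)))
      = -(C ((k + 1 : ℕ) : ℂ) * g (k + 1)) := by
    intro k
    simp only [hg]; push_cast
    simp only [map_mul, map_neg, map_add, map_one, map_natCast]; ring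
  simp only [f1, f2]
  -- Both sums extend to the full range because the added terms carry a zero factor; termwise the
  -- coefficients then add up to (n + 1 - k) + k = n + 1.
  have g1 : ∑ k ∈ Finset.range (n + 1), -(C (n + 1 - k : ℂ) * g k) =
      ∑ k ∈ Finset.range (n + 2), -(C (n + 1 - k : ℂ) * g k) := by
    rw [Finset.sum_range_succ _ (n + 1)]; simp
  have g2 : ∑ k ∈ Finset.range (n + 1), -(C ((k + 1 : ℕ) : ℂ) * g (k + 1)) =
      ∑ k ∈ Finset.range (n + 2), -(C ((k : ℕ) : ℂ) * g k) := by
    rw [Finset.sum_range_succ' _ (n + 1)]; simp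
  rw [g1, g2, ← Finset.sum_add_distrib, Finset.mul_sum, Finset.mul_sum, Finset.mul_sum]
  refine Finset.sum_congr rfl fun k _ => ?_
  have hC : C ((2 : ℂ)⁻¹ ^ n) = C ((2 : ℂ)⁻¹ ^ (n + 1)) * C 2 := by
    rw [← C_mul, pow_succ]; simp
  rw [hC]
  simp only [map_mul, map_neg, map_add, map_one, map_natCast, map_sub, map_ofNat]; ring

lemma jacobiP_zero (α β : ℝ) : jacobiP 0 α β = 1 := by simp [jacobiP]

lemma coeff_pearsonOp (α β : ℝ) {m : ℕ} {f : ℂ[X]} (hf : f.natDegree ≤ m) :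
    (pearsonOp α β f).coeff (m + 1) = -(m + 2 + α + β) * f.coeff m := by
  have h0 : f.coeff (m + 1) = 0 := coeff_eq_zero_of_natDegree_lt (by omega)
  have h2 : f.coeff (m + 2) = 0 := coeff_eq_zero_of_natDegree_lt (by omega)
  have : pearsonOp α β f = derivative f - derivative (X ^ 2 * f) + (C (β : ℂ) * f - C (β : ℂ) *
      (X * f)) - (C (α : ℂ) * f + C (α : ℂ) * (X * f)) := by
    simp only [pearsonOp, sub_mul, one_mul, derivative_sub]; ring
  rw [this]
  simp only [coeff_sub, coeff_add, coeff_derivative, coeff_C_mul, coeff_X_mul, h0, h2]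
  rw [show m + 1 + 1 = m + 2 from rfl, coeff_X_pow_mul]
  push_cast; ring

lemma natDegree_jacobiP_le (n : ℕ) (α β : ℝ) : (jacobiP n α β).natDegree ≤ n := by
  refine (natDegree_C_mul_le _ _).trans (natDegree_sum_le_of_forall_le _ _ fun k hk => ?_)
  have hk := Finset.mem_range.mp hk
  have h1 : ((X : ℂ[X]) - 1).natDegree ≤ 1 := (natDegree_X_sub_C (1 : ℂ)).le
  have h2 : ((X : ℂ[X]) + 1).natDegree ≤ 1 := (natDegree_X_add_C (1 : ℂ)).le
  refine (natDegree_C_mul_le _ _).trans (natDegree_mul_le.trans ?_)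
  have a1 := natDegree_pow_le_of_le k h1
  have a2 := natDegree_pow_le_of_le (n - k) h2
  omega

/-- Induction along the Rodrigues relation: each step multiplies the top coefficient by a factor
that vanishes only if α + β is an integer. -/
lemma coeff_jacobiP_ne_zero (n : ℕ) {α β : ℝ} (h : NotInt (α + β)) :
    (jacobiP n α β).coeff n ≠ 0 := by
  induction n generalizing α β with
  | zero => simp [jacobiP_zero]
  | succ n ih =>
    have h' : NotInt (α + 1 + (β + 1)) := by
      rw [show α + 1 + (β + 1) = α + β + 1 + 1 by ring]; exact h.add_one.add_one
    have h1 := coeff_pearsonOp α β (natDegree_jacobiP_le n (α + 1) (β + 1))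
    rw [pearsonOp_jacobiP, coeff_C_mul] at h1
    intro h0
    rw [h0, mul_zero] at h1
    refine mul_ne_zero (neg_ne_zero.mpr ?_) (ih h') h1.symm
    have := h.add_natCast_ne_zero (n + 2)
    push_cast at this
    convert this using 1; ring

lemma natDegree_jacobiP (n : ℕ) {α β : ℝ} (h : NotInt (α + β)) : (jacobiP n α β).natDegree = n :=
  le_antisymm (natDegree_jacobiP_le n α β) (le_natDegree_of_ne_zero (coeff_jacobiP_ne_zero n h))

/-- Repeated integration by parts in algebraic form. By the Rodrigues relation, `pearsonOp` of a
product moves one derivative to Q and leaves the factor 1 - X², which is absorbed by raising both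
parameters by 1. -/
lemma jacobiFunctional_jacobiP_mul (n : ℕ) {α β : ℝ} (h : NotInt (α + β)) (hα : NotInt α)
    (hβ : NotInt β) :
    ∃ c : ℂ, c ≠ 0 ∧ ∀ Q : ℂ[X], jacobiFunctional α β (jacobiP n α β * Q) =
      c * jacobiFunctional (α + n) (β + n) (derivative^[n] Q) := by
  induction n generalizing α β with
  | zero => exact ⟨1, one_ne_zero, fun Q => by simp [jacobiP_zero]⟩
  | succ n ih =>
    have h' : NotInt (α + 1 + (β + 1)) := by
      rw [show α + 1 + (β + 1) = α + β + 1 + 1 by ring]; exact h.add_one.add_one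
    obtain ⟨c, hc, H⟩ := ih h' hα.add_one hβ.add_one
    obtain ⟨c₁, hc₁, H₁⟩ := jacobiFunctional_one_add_X_mul h hβ
    obtain ⟨c₂, hc₂, H₂⟩ := jacobiFunctional_one_sub_X_mul (α := α) (β := β + 1)
      (by rw [← add_assoc]; exact h.add_one) hα
    have hn : (n + 1 : ℂ) ≠ 0 := by exact_mod_cast Nat.succ_ne_zero n
    refine ⟨c₁ * c₂ * c / (2 * (n + 1)), div_ne_zero (by simp [hc, hc₁, hc₂]) (by simp [hn]), fun Q => ?_⟩
    have hT : pearsonOp α β (jacobiP n (α + 1) (β + 1) * Q) =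
        C (-2 * (n + 1) : ℂ) * (jacobiP (n + 1) α β * Q) +
          (1 + X) * ((1 - X) * (jacobiP n (α + 1) (β + 1) * derivative Q)) := by
      rw [← mul_assoc, ← pearsonOp_jacobiP, pearsonOp, pearsonOp]
      simp only [derivative_mul]; ring
    have h0 := jacobiFunctional_pearsonOp h (jacobiP n (α + 1) (β + 1) * Q)
    rw [hT, map_add, H₁, H₂, H, ← smul_eq_C_mul, map_smul, smul_eq_mul] at h0
    rw [Function.iterate_succ_apply]
    have e1 : α + 1 + n = α + ((n + 1 : ℕ) : ℝ) := by push_cast; ring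
    have e2 : β + 1 + n = β + ((n + 1 : ℕ) : ℝ) := by push_cast; ring
    rw [e1, e2] at h0
    field_simp
    linear_combination -h0

lemma jacobiFunctional_jacobiP_mul_eq_zero {n : ℕ} {α β : ℝ} (h : NotInt (α + β)) (hα : NotInt α)
    (hβ : NotInt β) {Q : ℂ[X]} (hQ : Q.degree < n) :
    jacobiFunctional α β (jacobiP n α β * Q) = 0 := by
  obtain ⟨c, -, H⟩ := jacobiFunctional_jacobiP_mul n h hα hβ
  rw [H]
  by_cases h0 : Q = 0
  · simp [h0]
  · rw [iterate_derivative_eq_zero ((natDegree_lt_iff_degree_lt h0).mpr hQ)]; simp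

lemma jacobiFunctional_jacobiP_mul_ne_zero {n : ℕ} {α β : ℝ} (h : NotInt (α + β)) (hα : NotInt α)
    (hβ : NotInt β) {Q : ℂ[X]} (hQ : Q.degree = n) :
    jacobiFunctional α β (jacobiP n α β * Q) ≠ 0 := by
  obtain ⟨c, hc, H⟩ := jacobiFunctional_jacobiP_mul n h hα hβ
  have hn := natDegree_eq_of_degree_eq_some hQ
  have hQ0 : Q ≠ 0 := by rintro rfl; simp at hQ
  have hd : (derivative^[n] Q).natDegree = 0 := by
    have := natDegree_iterate_derivative Q n
    omega
  rw [H, eq_C_of_natDegree_eq_zero hd, coeff_iterate_derivative]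
  rw [← mul_one (C _), ← smul_eq_C_mul, map_smul, jacobiFunctional_one]
  have : Q.coeff n ≠ 0 := by rw [← hn]; simpa using hQ0
  simp [hc, this, Nat.descFactorial_self, Nat.factorial_ne_zero]

/-- Subtract the multiple of P that cancels the coefficient of Xⁿ. A nonzero remainder r would have
degree < n and be orthogonal to the Jacobi polynomial of degree deg r, against which its functional
value is nonzero. -/
lemma eq_C_mul_jacobiP_of_orthogonal {n : ℕ} {α β : ℝ} (h : NotInt (α + β)) (hα : NotInt α)
    (hβ : NotInt β) {p : ℂ[X]} (hp : p.natDegree ≤ n)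
    (ho : ∀ Q : ℂ[X], Q.degree < n → jacobiFunctional α β (p * Q) = 0) :
    ∃ c : ℂ, p = C c * jacobiP n α β := by
  set P := jacobiP n α β
  have hP : P.coeff n ≠ 0 := coeff_jacobiP_ne_zero n h
  refine ⟨p.coeff n / P.coeff n, ?_⟩
  set r := p - C (p.coeff n / P.coeff n) * P with hr
  suffices r = 0 from sub_eq_zero.mp this
  by_contra hr0
  have hdeg : r.natDegree ≤ n := (natDegree_sub_le_of_le hp
    ((natDegree_C_mul_le _ _).trans (natDegree_jacobiP_le n α β))).trans (max_self n).le
  have hlt : r.natDegree < n := by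
    refine lt_of_le_of_ne hdeg fun e => hr0 ?_
    rw [← leadingCoeff_eq_zero, leadingCoeff, e, hr]
    simp [hP]
  refine jacobiFunctional_jacobiP_mul_ne_zero h hα hβ (degree_eq_natDegree hr0) ?_
  have hk : (jacobiP r.natDegree α β).degree < n :=
    degree_le_natDegree.trans_lt (by
      rw [natDegree_jacobiP _ h]; exact_mod_cast hlt)
  have e : jacobiP r.natDegree α β * r = p * jacobiP r.natDegree α β -
      C (p.coeff n / P.coeff n) * (P * jacobiP r.natDegree α β) := by
    rw [hr]; ring
  rw [e, map_sub, ho _ hk, ← smul_eq_C_mul, map_smul,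
    jacobiFunctional_jacobiP_mul_eq_zero h hα hβ hk]
  simp

/-! ### The fundamental theorem of calculus on open intervals. -/

/-- An open interval `I` that is exhausted by compact intervals whose left (right) end points tend
to `l₁` (to `l₂`). -/
structure IsExhausted (I : Set ℝ) (l₁ l₂ : Filter ℝ) : Prop where
  isOpen : IsOpen I
  ordConnected : I.OrdConnected
  nonempty : I.Nonempty
  exists_seq : ∃ a b : ℕ → ℝ, (∀ i, a i ∈ I ∧ b i ∈ I ∧ a i ≤ b i) ∧
    (∀ x ∈ I, ∀ᶠ i in atTop, x ∈ Ioc (a i) (b i)) ∧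
    Tendsto a atTop l₁ ∧ Tendsto b atTop l₂

lemma isExhausted_Ioo {c d : ℝ} (h : c < d) : IsExhausted (Ioo c d) (𝓝[>] c) (𝓝[<] d) := by
  refine ⟨isOpen_Ioo, ordConnected_Ioo, nonempty_Ioo.mpr h, ?_⟩
  obtain ⟨a, -, ha, ha'⟩ := exists_seq_strictAnti_tendsto' (show c < (c + d) / 2 by linarith)
  obtain ⟨b, -, hb, hb'⟩ := exists_seq_strictMono_tendsto' (show (c + d) / 2 < d by linarith)
  refine ⟨a, b, fun i => ⟨⟨(ha i).1, by linarith [(ha i).2]⟩, ⟨by linarith [(hb i).1], (hb i).2⟩,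
    by linarith [(ha i).2, (hb i).1]⟩, fun x hx => ?_, ?_, ?_⟩
  · filter_upwards [ha'.eventually (gt_mem_nhds hx.1), hb'.eventually (lt_mem_nhds hx.2)]
      with i h1 h2 using ⟨h1, h2.le⟩
  · exact tendsto_nhdsWithin_iff.mpr ⟨ha', .of_forall fun i => (ha i).1⟩
  · exact tendsto_nhdsWithin_iff.mpr ⟨hb', .of_forall fun i => (hb i).2⟩

lemma isExhausted_univ : IsExhausted univ atBot atTop := by
  refine ⟨isOpen_univ, ordConnected_univ, univ_nonempty, fun i => -(i : ℝ), fun i => i, fun i =>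
    ⟨trivial, trivial, by linarith [(Nat.cast_nonneg i : (0 : ℝ) ≤ i)]⟩, fun x _ => ?_,
    tendsto_neg_atTop_atBot.comp tendsto_natCast_atTop_atTop, tendsto_natCast_atTop_atTop⟩
  filter_upwards [tendsto_natCast_atTop_atTop.eventually_gt_atTop |x|] with i hi
  rw [abs_lt] at hi
  exact ⟨by linarith, hi.2.le⟩

lemma isExhausted_Iio (c : ℝ) : IsExhausted (Iio c) atBot (𝓝[<] c) := by
  refine ⟨isOpen_Iio, ordConnected_Iio, nonempty_Iio, ?_⟩
  obtain ⟨b, -, hb, hb'⟩ := exists_seq_strictMono_tendsto' (show c - 1 < c by linarith)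
  have ht : Tendsto (fun i : ℕ => c - 1 - (i : ℝ)) atTop atBot :=
    tendsto_atBot_add_const_left _ _ (tendsto_neg_atTop_atBot.comp tendsto_natCast_atTop_atTop)
  have hp : ∀ i : ℕ, (0 : ℝ) ≤ i := fun i => Nat.cast_nonneg i
  refine ⟨fun i => c - 1 - (i : ℝ), b, fun i => ⟨?_, (hb i).2, ?_⟩, fun x hx => ?_, ht, ?_⟩
  · show c - 1 - (i : ℝ) < c
    linarith [hp i]
  · linarith [hp i, (hb i).1]
  · filter_upwards [ht.eventually_lt_atBot x, hb'.eventually (lt_mem_nhds hx)]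
      with i h1 h2 using ⟨h1, h2.le⟩
  · exact tendsto_nhdsWithin_iff.mpr ⟨hb', .of_forall fun i => (hb i).2⟩

/-- The fundamental theorem of calculus on an open interval, for primitives with finite limits at
the ends and finitely many exceptional points. -/
lemma IsExhausted.integral_eq {I : Set ℝ} {l₁ l₂ : Filter ℝ} (hI : IsExhausted I l₁ l₂)
    {S : Finset ℝ} {Φ g : ℝ → ℂ} (hc : ContinuousOn Φ I)
    (hd : ∀ s ∈ I, s ∉ S → HasDerivAt Φ (g s) s) (hg : IntegrableOn g I) {u v : ℂ}
    (hu : Tendsto Φ l₁ (𝓝 u)) (hv : Tendsto Φ l₂ (𝓝 v)) : ∫ s in I, g s = v - u := by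
  obtain ⟨a, b, hab, hcov, ha, hb⟩ := hI.exists_seq
  have hsub : ∀ i, Icc (a i) (b i) ⊆ I := fun i => hI.ordConnected.out (hab i).1 (hab i).2.1
  have hcover : AECover (volume.restrict I) atTop (fun i => Ioc (a i) (b i)) :=
    ⟨(ae_restrict_iff' hI.isOpen.measurableSet).mpr (.of_forall hcov), fun i => measurableSet_Ioc⟩
  have h1 := hcover.integral_tendsto_of_countably_generated hg
  have h2 : ∀ i, ∫ s in Ioc (a i) (b i), g s ∂(volume.restrict I) = Φ (b i) - Φ (a i) := by
    intro i
    rw [Measure.restrict_restrict measurableSet_Ioc,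
      inter_eq_left.mpr (Ioc_subset_Icc_self.trans (hsub i)),
      ← intervalIntegral.integral_of_le (hab i).2.2]
    refine integral_eq_of_hasDerivAt_off_countable_of_le Φ g (hab i).2.2 S.countable_toSet
      (hc.mono (hsub i)) (fun x hx => hd x (hsub i (Ioo_subset_Icc_self hx.1)) hx.2) ?_
    exact (intervalIntegrable_iff_integrableOn_Icc_of_le (hab i).2.2 enorm_ne_top).mpr
      (hg.mono_set (hsub i))
  simp only [h2] at h1
  exact tendsto_nhds_unique h1 ((hv.comp hb).sub (hu.comp ha))

/-! ### Branches of the weight along a curve. -/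

lemma norm_of_mem_weightValues {α β : ℝ} {z v : ℂ} (h : v ∈ weightValues α β z) :
    ‖v‖ = ‖1 - z‖ ^ α * ‖z + 1‖ ^ β := by
  obtain ⟨l₁, l₂, h1, h2, rfl⟩ := h
  rw [← h1, ← h2, Complex.norm_exp, Complex.norm_exp, Complex.norm_exp, ← Real.exp_mul,
    ← Real.exp_mul, ← Real.exp_add]
  simp [mul_comm]

lemma ne_zero_of_mem_weightValues {α β : ℝ} {z v : ℂ} (h : v ∈ weightValues α β z) :
    v ≠ 0 ∧ 1 - z ≠ 0 ∧ z + 1 ≠ 0 := by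
  obtain ⟨l₁, l₂, h1, h2, rfl⟩ := h
  rw [← h1, ← h2]
  exact ⟨Complex.exp_ne_zero _, Complex.exp_ne_zero _, Complex.exp_ne_zero _⟩

/-- Two branches of a weight along a curve differ by a constant factor. -/
lemma IsWeightBranch.eq_const_mul {α β : ℝ} {I : Set ℝ} {γ W V : ℝ → ℂ} (hI : IsPreconnected I)
    (hne : I.Nonempty) (hW : IsWeightBranch α β I γ W) (hV : IsWeightBranch α β I γ V) :
    ∃ c : ℂ, c ≠ 0 ∧ ∀ s ∈ I, W s = c * V s := by
  have hV0 : ∀ s ∈ I, V s ≠ 0 := fun s hs => (ne_zero_of_mem_weightValues (hV.2 s hs)).1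
  have hcont : ContinuousOn (fun s => W s / V s) I := hW.1.div hV.1 hV0
  -- The quotient of two branches takes values in this countable, hence totally disconnected, set;
  -- being continuous on a connected set it is constant.
  set T : Set ℂ := range fun p : ℤ × ℤ =>
    Complex.exp (α * (p.1 * (2 * Real.pi * Complex.I)) + β * (p.2 * (2 * Real.pi * Complex.I)))
  have hT : T.Countable := countable_range _
  have hmem : (fun s => W s / V s) '' I ⊆ T := by
    rintro _ ⟨s, hs, rfl⟩
    obtain ⟨l₁, l₂, h1, h2, h3⟩ := hW.2 s hs
    obtain ⟨m₁, m₂, k1, k2, k3⟩ := hV.2 s hs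
    obtain ⟨n₁, e1⟩ := Complex.exp_eq_exp_iff_exists_int.mp (h1.trans k1.symm)
    obtain ⟨n₂, e2⟩ := Complex.exp_eq_exp_iff_exists_int.mp (h2.trans k2.symm)
    refine ⟨(n₁, n₂), ?_⟩
    change Complex.exp _ = W s / V s
    rw [h3, k3, ← Complex.exp_sub, e1, e2]
    congr 1; ring
  have hsub := hT.isTotallyDisconnected _ hmem (hI.image _ hcont)
  obtain ⟨s₀, hs₀⟩ := hne
  refine ⟨W s₀ / V s₀, div_ne_zero (ne_zero_of_mem_weightValues (hW.2 s₀ hs₀)).1 (hV0 s₀ hs₀),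
    fun s hs => ?_⟩
  have : W s / V s = W s₀ / V s₀ := hsub (mem_image_of_mem _ hs) (mem_image_of_mem _ hs₀)
  rw [← this, div_mul_cancel₀ _ (hV0 s hs)]

lemma IsWeightBranch.mono {α β : ℝ} {I J : Set ℝ} {γ W : ℝ → ℂ} (hW : IsWeightBranch α β I γ W)
    (h : J ⊆ I) : IsWeightBranch α β J γ W := ⟨hW.1.mono h, fun s hs => hW.2 s (h hs)⟩

lemma isWeightBranch_of_log {α β : ℝ} {I : Set ℝ} {γ l₁ l₂ : ℝ → ℂ} (h1 : ContinuousOn l₁ I)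
    (h2 : ContinuousOn l₂ I) (e1 : ∀ s ∈ I, Complex.exp (l₁ s) = 1 - γ s)
    (e2 : ∀ s ∈ I, Complex.exp (l₂ s) = γ s + 1) :
    IsWeightBranch α β I γ fun s => Complex.exp (α * l₁ s + β * l₂ s) :=
  ⟨((continuousOn_const.mul h1).add (continuousOn_const.mul h2)).cexp,
    fun s hs => ⟨l₁ s, l₂ s, e1 s hs, e2 s hs, rfl⟩⟩

/-- The logarithmic derivative of a branch of the weight along a differentiable curve. -/
lemma IsWeightBranch.hasDerivAt {α β : ℝ} {I : Set ℝ} {γ W : ℝ → ℂ} (hI : IsOpen I)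
    (hγ : ContinuousOn γ I) (hW : IsWeightBranch α β I γ W) {s : ℝ} (hs : s ∈ I) {γ' : ℂ}
    (hd : HasDerivAt γ γ' s) :
    HasDerivAt W (W s * (-α / (1 - γ s) + β / (γ s + 1)) * γ') s := by
  obtain ⟨hW0, hz1, hz2⟩ := ne_zero_of_mem_weightValues (hW.2 s hs)
  obtain ⟨m₁, m₂, k1, k2, k3⟩ := hW.2 s hs
  -- Normalizing to the value 1 at s keeps both quotients in the slit plane near s, where principal
  -- logarithms give an explicit differentiable branch equal to W at s.
  set g₁ : ℝ → ℂ := fun t => (1 - γ t) / (1 - γ s)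
  set g₂ : ℝ → ℂ := fun t => (γ t + 1) / (γ s + 1)
  have c1 : ContinuousOn g₁ I := (continuousOn_const.sub hγ).div_const _
  have c2 : ContinuousOn g₂ I := (hγ.add continuousOn_const).div_const _
  have v1 : g₁ s = 1 := div_self hz1
  have v2 : g₂ s = 1 := div_self hz2
  have hIs : I ∈ 𝓝 s := hI.mem_nhds hs
  have n1 : ∀ᶠ t in 𝓝 s, g₁ t ∈ Complex.slitPlane :=
    (c1.continuousAt hIs).eventually_mem (by
      rw [v1]; exact Complex.isOpen_slitPlane.mem_nhds (by simp))
  have n2 : ∀ᶠ t in 𝓝 s, g₂ t ∈ Complex.slitPlane :=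
    (c2.continuousAt hIs).eventually_mem (by
      rw [v2]; exact Complex.isOpen_slitPlane.mem_nhds (by simp))
  obtain ⟨ε, hε, hball⟩ := Metric.eventually_nhds_iff_ball.mp ((n1.and n2).and hIs)
  set B := Metric.ball s ε
  have hBI : B ⊆ I := fun t ht => (hball t ht).2
  set V : ℝ → ℂ := fun t =>
    Complex.exp (α * (m₁ + Complex.log (g₁ t)) + β * (m₂ + Complex.log (g₂ t)))
  have hV : IsWeightBranch α β B γ V := by
    refine isWeightBranch_of_log
      (continuousOn_const.add ((c1.mono hBI).clog fun t ht => (hball t ht).1.1))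
      (continuousOn_const.add ((c2.mono hBI).clog fun t ht => (hball t ht).1.2)) ?_ ?_
    · intro t ht
      rw [Complex.exp_add, k1, Complex.exp_log (Complex.slitPlane_ne_zero (hball t ht).1.1),
        mul_div_cancel₀ _ hz1]
    · intro t ht
      rw [Complex.exp_add, k2, Complex.exp_log (Complex.slitPlane_ne_zero (hball t ht).1.2),
        mul_div_cancel₀ _ hz2]
  have hsB : s ∈ B := Metric.mem_ball_self hε
  have hVs : V s = W s := by simp [V, v1, v2, k3]
  obtain ⟨c, -, hc⟩ := (hW.mono hBI).eq_const_mul (convex_ball s ε).isPreconnected ⟨s, hsB⟩ hV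
  have hc1 : c = 1 := by
    have := hc s hsB
    rw [hVs] at this
    exact mul_right_cancel₀ hW0 (by rw [← this, one_mul])
  have hVW : W =ᶠ[𝓝 s] V := by
    filter_upwards [Metric.ball_mem_nhds s hε] with t ht
    rw [hc t ht, hc1, one_mul]
  refine HasDerivAt.congr_of_eventuallyEq ?_ hVW
  have d1 : HasDerivAt (fun t => Complex.log (g₁ t)) (-γ' / (1 - γ s) / g₁ s) s :=
    ((hd.const_sub 1).div_const (1 - γ s)).clog_real (by change g₁ s ∈ _; rw [v1]; simp)
  have d2 : HasDerivAt (fun t => Complex.log (g₂ t)) (γ' / (γ s + 1) / g₂ s) s :=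
    ((hd.add_const 1).div_const (γ s + 1)).clog_real (by change g₂ s ∈ _; rw [v2]; simp)
  have := (((d1.const_add m₁).const_mul (α : ℂ)).add ((d2.const_add m₂).const_mul (β : ℂ))).cexp
  refine this.congr_deriv ?_
  change V s * _ = _
  rw [v1, v2, hVs]
  field_simp

/-! ### Integration against the weight as a multiple of the functional. -/

lemma norm_eval_le (Q : ℂ[X]) {N : ℕ} (hQ : Q.natDegree ≤ N) :
    ∃ K : ℝ, 0 ≤ K ∧ ∀ z : ℂ, ‖Q.eval z‖ ≤ K * (1 + ‖z‖) ^ N := by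
  refine ⟨∑ i ∈ Finset.range (Q.natDegree + 1), ‖Q.coeff i‖,
    Finset.sum_nonneg fun _ _ => norm_nonneg _, fun z => ?_⟩
  rw [eval_eq_sum_range, Finset.sum_mul]
  refine (norm_sum_le _ _).trans (Finset.sum_le_sum fun i hi => ?_)
  rw [norm_mul, norm_pow]
  have h1 : 1 ≤ 1 + ‖z‖ := by linarith [norm_nonneg z]
  have h2 : i ≤ N := by have := Finset.mem_range.mp hi; omega
  gcongr
  exact (pow_le_pow_left₀ (norm_nonneg z) (by linarith) i).trans (pow_le_pow_right₀ h1 h2)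

lemma integrableOn_eval_mul_weight {α β : ℝ} {I : Set ℝ} {γ W : ℝ → ℂ} (hI : IsOpen I)
    (hγ : ContinuousOn γ I) (hW : IsWeightBranch α β I γ W) {N : ℕ}
    (hint : IntegrableOn
      (fun s => ‖1 - γ s‖ ^ α * ‖γ s + 1‖ ^ β * (1 + ‖γ s‖) ^ N * ‖deriv γ s‖) I)
    {Q : ℂ[X]} (hQ : Q.natDegree ≤ N) :
    IntegrableOn (fun s => Q.eval (γ s) * W s * deriv γ s) I := by
  obtain ⟨K, hK, hb⟩ := norm_eval_le Q hQ
  refine (hint.const_mul K).mono' ?_ ?_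
  · exact (((Q.continuous.comp_continuousOn hγ).mul hW.1).aestronglyMeasurable
      hI.measurableSet).mul (measurable_deriv γ).aestronglyMeasurable
  · refine (ae_restrict_iff' hI.measurableSet).mpr (.of_forall fun s hs => ?_)
    rw [norm_mul, norm_mul, norm_of_mem_weightValues (hW.2 s hs)]
    have := hb (γ s)
    calc _ ≤ (K * (1 + ‖γ s‖) ^ N) * (‖1 - γ s‖ ^ α * ‖γ s + 1‖ ^ β) * ‖deriv γ s‖ := by gcongr
      _ = _ := by ring

/-- If boundary terms vanish, integration against a branch of the weight is a multiple of the
Jacobi functional. -/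
lemma IsExhausted.hasContourIntegral {α β : ℝ} {I : Set ℝ} {l₁ l₂ : Filter ℝ} {γ W : ℝ → ℂ}
    (hI : IsExhausted I l₁ l₂) (hγ : IsPiecewiseC1 I γ) (hW : IsWeightBranch α β I γ W)
    (hαβ : NotInt (α + β)) {N : ℕ}
    (hint : IntegrableOn
      (fun s => ‖1 - γ s‖ ^ α * ‖γ s + 1‖ ^ β * (1 + ‖γ s‖) ^ N * ‖deriv γ s‖) I)
    (hl₁ : ∀ᶠ s in l₁, s ∈ I) (hl₂ : ∀ᶠ s in l₂, s ∈ I)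
    (h₁ : ∀ k < N, Tendsto
      (fun s => ‖1 - γ s‖ ^ (α + 1) * ‖γ s + 1‖ ^ (β + 1) * (1 + ‖γ s‖) ^ k) l₁ (𝓝 0))
    (h₂ : ∀ k < N, Tendsto
      (fun s => ‖1 - γ s‖ ^ (α + 1) * ‖γ s + 1‖ ^ (β + 1) * (1 + ‖γ s‖) ^ k) l₂ (𝓝 0))
    {Q : ℂ[X]} (hQ : Q.natDegree ≤ N) :
    HasContourIntegral I γ (fun s => Q.eval (γ s) * W s)
      ((∫ s in I, W s * deriv γ s) * jacobiFunctional α β Q) := by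
  have hi : ∀ {R : ℂ[X]}, R.natDegree ≤ N →
      IntegrableOn (fun s => R.eval (γ s) * W s * deriv γ s) I := fun hR =>
    integrableOn_eval_mul_weight hI.isOpen hγ.1 hW hint hR
  refine ⟨hi hQ, ?_⟩
  obtain ⟨S, hS⟩ := hγ.2
  set E : ℕ → ℂ[X] := fun k => (X + 1) ^ k with hE
  have hEdeg : ∀ k, (E k).natDegree = k := fun k => by
    simpa [hE] using natDegree_pow_X_add_C (R := ℂ) k 1
  set μ : ℕ → ℂ := fun k => ∫ s in I, (E k).eval (γ s) * W s * deriv γ s with hμ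
  -- The recurrence says that the derivative of (1 - t²)(t + 1)^k w integrates to zero, its boundary
  -- values being zero.
  have hrec : ∀ k < N, (k + 2 + α + β : ℂ) * μ (k + 1) = 2 * (k + 1 + β) * μ k := by
    intro k hk
    have bound : ∀ l : Filter ℝ, (∀ᶠ s in l, s ∈ I) → Tendsto
        (fun s => ‖1 - γ s‖ ^ (α + 1) * ‖γ s + 1‖ ^ (β + 1) * (1 + ‖γ s‖) ^ k) l (𝓝 0) →
        Tendsto (fun s => (1 - γ s ^ 2) * (E k).eval (γ s) * W s) l (𝓝 0) := by
      intro l hl ht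
      obtain ⟨K, hK, hb⟩ := norm_eval_le (E k) (hEdeg k).le
      refine squeeze_zero_norm' ?_ (by simpa using ht.const_mul K)
      filter_upwards [hl] with s hs
      obtain ⟨-, hz1, hz2⟩ := ne_zero_of_mem_weightValues (hW.2 s hs)
      rw [norm_mul, norm_mul, norm_of_mem_weightValues (hW.2 s hs),
        show (1 - γ s ^ 2) = (1 - γ s) * (γ s + 1) by ring, norm_mul,
        Real.rpow_add_one (norm_ne_zero_iff.mpr hz1), Real.rpow_add_one (norm_ne_zero_iff.mpr hz2)]
      calc _ ≤ ‖1 - γ s‖ * ‖γ s + 1‖ * (K * (1 + ‖γ s‖) ^ k) *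
            (‖1 - γ s‖ ^ α * ‖γ s + 1‖ ^ β) := by gcongr; exact hb _
        _ = _ := by ring
    have hcont : ContinuousOn (fun s => (1 - γ s ^ 2) * (E k).eval (γ s) * W s) I :=
      ((continuousOn_const.sub (hγ.1.pow 2)).mul ((E k).continuous.comp_continuousOn hγ.1)).mul hW.1
    have i1 := (hi (R := E k) (by rw [hEdeg]; omega)).const_mul (2 * (k + 1 + β) : ℂ)
    have i2 := (hi (R := E (k + 1)) (by rw [hEdeg]; omega)).const_mul (k + 2 + α + β : ℂ)
    have key := hI.integral_eq (S := S) hcont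
      (g := fun s => 2 * (k + 1 + β) * ((E k).eval (γ s) * W s * deriv γ s) -
        (k + 2 + α + β) * ((E (k + 1)).eval (γ s) * W s * deriv γ s)) (fun s hs hsS => ?_)
      (i1.sub i2) (bound l₁ hl₁ (h₁ k hk)) (bound l₂ hl₂ (h₂ k hk))
    · rw [integral_sub i1 i2, integral_const_mul, integral_const_mul, sub_self, sub_eq_zero] at key
      exact key.symm
    · obtain ⟨-, hz1, hz2⟩ := ne_zero_of_mem_weightValues (hW.2 s hs)
      have hd : HasDerivAt γ (deriv γ s) s :=
        ((hS s hs hsS).differentiableAt (by norm_num)).hasDerivAt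
      have hWd := hW.hasDerivAt hI.isOpen hγ.1 hs hd
      have hp := (((1 - X ^ 2) * E k).hasDerivAt (γ s)).comp s hd
      have e : pearsonOp α β (E k) = _ := pearsonOp_pow α β k
      have := hp.mul hWd
      refine HasDerivAt.congr_deriv (f := fun s => (1 - γ s ^ 2) * (E k).eval (γ s) * W s)
        (this.congr_of_eventuallyEq (.of_forall fun t => by simp)) ?_
      have e' := congrArg (Polynomial.eval (γ s)) e
      simp only [pearsonOp, eval_add, eval_sub, eval_mul, eval_C, eval_one, eval_X, eval_pow] at e'
      have e2 : (E (k + 1)).eval (γ s) = (γ s + 1) ^ (k + 1) := by simp [hE]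
      have e3 : (E k).eval (γ s) = (γ s + 1) ^ k := by simp [hE]
      rw [e2, e3]
      rw [e3] at e'
      simp only [Function.comp, eval_mul, eval_sub, eval_one, eval_pow, eval_X, e3]
      -- The factor 1 - t² cancels both poles of the logarithmic derivative of the weight.
      have e4 : (1 - γ s ^ 2) * (W s * (-α / (1 - γ s) + β / (γ s + 1)) * deriv γ s) =
          (β * (1 - γ s) - α * (1 + γ s)) * W s * deriv γ s := by
        field_simp; ring
      linear_combination (W s * deriv γ s) * e' + (γ s + 1) ^ k * e4
  have hμk := eq_jacobiMoment_of_recurrence hαβ hrec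
  have hμ0 : μ 0 = ∫ s in I, W s * deriv γ s := by simp [hμ, hE]
  have hrep := exists_sum_X_add_one_pow Q
  set a := fun k => (taylor (-1) Q).coeff k
  have hsum : ∀ s, Q.eval (γ s) * W s * deriv γ s =
      ∑ k ∈ Finset.range (Q.natDegree + 1), a k * ((E k).eval (γ s) * W s * deriv γ s) := by
    intro s
    conv_lhs => rw [hrep]
    rw [eval_finsetSum, Finset.sum_mul, Finset.sum_mul]
    refine Finset.sum_congr rfl fun k _ => ?_
    simp only [eval_mul, eval_C, a, hE]; ring
  have hk : ∀ k ∈ Finset.range (Q.natDegree + 1), k ≤ N := fun k hk => by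
    have := Finset.mem_range.mp hk; omega
  simp only [hsum]
  rw [integral_finsetSum _ fun k hk' => (hi (R := E k) (by rw [hEdeg]; exact hk k hk')).const_mul _]
  conv_rhs => rw [hrep, map_sum, Finset.mul_sum]
  refine Finset.sum_congr rfl fun k hk' => ?_
  have := hμk k (hk k hk')
  rw [hμ0] at this
  rw [integral_const_mul, ← smul_eq_C_mul, map_smul, jacobiFunctional_pow, smul_eq_mul]
  change a k * μ k = _
  rw [this]; ring

/-! ### The model integral of v^A (1 + v)^B around the slit. -/

/-- A primitive of `v ↦ v^A (1 + v)^B` on the slit plane, normalized to vanish at `0`. -/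
def betaPrimitive (A B : ℝ) (v : ℂ) : ℂ :=
  v ^ ((A + 1 : ℝ) : ℂ) * ∫ u in (0 : ℝ)..1, ((u ^ A : ℝ) : ℂ) * (1 + u * v) ^ (B : ℂ)

lemma one_add_mul_mem_slitPlane {v : ℂ} (hv : v ∈ Complex.slitPlane) {u : ℝ} (hu : 0 ≤ u) :
    1 + u * v ∈ Complex.slitPlane := by
  rcases hu.eq_or_lt with rfl | hu
  · simp
  · rw [Complex.mem_slitPlane_iff] at hv ⊢
    rcases hv with h | h
    · left; simp; positivity
    · right; simp [h, hu.ne']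

/-- The substitution of u v for the variable turns the integral from 0 to v into one over [0, 1]
with v as a parameter. Differentiation under the integral sign is legitimate by compactness, and an
integration by parts in u recombines the two terms. -/
lemma hasDerivAt_betaPrimitive {A B : ℝ} (hA : 0 < A) {v : ℂ} (hv : v ∈ Complex.slitPlane) :
    HasDerivAt (betaPrimitive A B) (v ^ (A : ℂ) * (1 + v) ^ (B : ℂ)) v := by
  have hv0 := Complex.slitPlane_ne_zero hv
  obtain ⟨ε, hε, hball⟩ := Metric.nhds_basis_closedBall.mem_iff.mp
    (Complex.isOpen_slitPlane.mem_nhds hv)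
  have hAc : Continuous fun u : ℝ => ((u ^ A : ℝ) : ℂ) :=
    Complex.continuous_ofReal.comp (Real.continuous_rpow_const hA.le)
  have hcont : ∀ c : ℂ, ∀ w ∈ Complex.slitPlane,
      ContinuousOn (fun u : ℝ => (1 + u * w) ^ c) (Icc 0 1) := fun c w hw =>
    ContinuousOn.cpow_const (by fun_prop) fun u hu => one_add_mul_mem_slitPlane hw hu.1
  set G' : ℂ → ℝ → ℂ := fun w u => ((u ^ A : ℝ) : ℂ) * (B * (1 + u * w) ^ ((B : ℂ) - 1) * u)
  have hG'cont : ContinuousOn (fun p : ℂ × ℝ => G' p.1 p.2) (Metric.closedBall v ε ×ˢ Icc 0 1) := by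
    refine ((hAc.comp continuous_snd).continuousOn).mul ((continuousOn_const.mul
      (ContinuousOn.cpow_const (by fun_prop) fun p hp => ?_)).mul (by fun_prop))
    exact one_add_mul_mem_slitPlane (hball hp.1) hp.2.1
  obtain ⟨K, hK⟩ := ((isCompact_closedBall v ε).prod isCompact_Icc).exists_bound_of_continuousOn
    hG'cont
  have hIoc : uIoc (0 : ℝ) 1 ⊆ Icc 0 1 := by
    rw [uIoc_of_le zero_le_one]; exact Ioc_subset_Icc_self
  have huIcc : uIcc (0 : ℝ) 1 = Icc 0 1 := uIcc_of_le zero_le_one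
  have key := intervalIntegral.hasDerivAt_integral_of_dominated_loc_of_deriv_le (μ := volume)
    (a := 0) (b := 1) (F := fun w u => ((u ^ A : ℝ) : ℂ) * (1 + u * w) ^ (B : ℂ)) (F' := G')
    (x₀ := v) (bound := fun _ => K) (Metric.closedBall_mem_nhds v hε) ?_ ?_ ?_ ?_ ?_ ?_
  rotate_left
  · filter_upwards [Complex.isOpen_slitPlane.mem_nhds hv] with w hw
    exact ((hAc.continuousOn.mul (hcont B w hw)).mono hIoc).aestronglyMeasurable measurableSet_uIoc
  · exact ((hAc.continuousOn.mul (hcont B v hv)).mono huIcc.subset).intervalIntegrable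
  · refine ContinuousOn.aestronglyMeasurable ?_ measurableSet_uIoc
    exact (hAc.continuousOn.mul ((continuousOn_const.mul (hcont _ v hv)).mul
      (by fun_prop))).mono hIoc
  · exact .of_forall fun u hu w hw => hK (w, u) ⟨hw, hIoc hu⟩
  · exact intervalIntegrable_const
  · refine .of_forall fun u hu w hw => ?_
    have h1 : HasDerivAt (fun w : ℂ => 1 + (u : ℂ) * w) u w := by
      simpa using ((hasDerivAt_id w).const_mul (u : ℂ)).const_add 1
    exact (h1.cpow_const (one_add_mul_mem_slitPlane (hball hw) (hIoc hu).1)).const_mul _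
  have hG := key.2
  have hpow : HasDerivAt (fun w : ℂ => w ^ ((A + 1 : ℝ) : ℂ))
      (((A + 1 : ℝ) : ℂ) * v ^ (A : ℂ)) v := by
    have := (hasDerivAt_id v).cpow_const (c := ((A + 1 : ℝ) : ℂ)) hv
    simpa using this
  refine (hpow.mul hG).congr_deriv ?_
  -- Integrating the derivative of u^(A+1) (1 + uv)^B over [0, 1] yields (1 + v)^B, which is what
  -- the product rule requires.
  have hprim : ∀ u ∈ uIcc (0 : ℝ) 1,
      HasDerivAt (fun u : ℝ => ((u ^ (A + 1) : ℝ) : ℂ) * (1 + u * v) ^ (B : ℂ))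
        (((A + 1 : ℝ) : ℂ) * (((u ^ A : ℝ) : ℂ) * (1 + u * v) ^ (B : ℂ)) + v * G' v u) u := by
    intro u hu
    rw [huIcc] at hu
    have h1 : HasDerivAt (fun u : ℝ => ((u ^ (A + 1) : ℝ) : ℂ)) (((A + 1) * u ^ A : ℝ) : ℂ) u := by
      have := (Real.hasDerivAt_rpow_const (x := u) (p := A + 1) (.inr (by linarith))).ofReal_comp
      simpa using this
    have h2 : HasDerivAt (fun u : ℂ => 1 + u * v) v (u : ℂ) := by
      simpa using ((hasDerivAt_id (u : ℂ)).mul_const v).const_add 1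
    have h3 := (h2.cpow_const (c := (B : ℂ)) (one_add_mul_mem_slitPlane hv hu.1)).comp_ofReal
    refine (h1.mul h3).congr_deriv ?_
    have h4 : ((u ^ (A + 1) : ℝ) : ℂ) = ((u ^ A : ℝ) : ℂ) * u := by
      rcases hu.1.eq_or_lt with rfl | hu0
      · rw [Real.zero_rpow (by linarith)]; simp
      · rw [Real.rpow_add_one hu0.ne']; push_cast; rfl
    rw [h4]; simp only [G']; push_cast; ring
  have i1 : IntervalIntegrable (fun u : ℝ => ((u ^ A : ℝ) : ℂ) * (1 + u * v) ^ (B : ℂ)) volume 0 1 :=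
    ((hAc.continuousOn.mul (hcont B v hv)).mono huIcc.subset).intervalIntegrable
  have hint := intervalIntegral.integral_eq_sub_of_hasDerivAt hprim
    ((i1.const_mul _).add (key.1.const_mul _))
  rw [intervalIntegral.integral_add (i1.const_mul _) (key.1.const_mul _),
    intervalIntegral.integral_const_mul, intervalIntegral.integral_const_mul] at hint
  have hzero : (0 : ℝ) ^ (A + 1) = 0 := Real.zero_rpow (by linarith)
  rw [hzero] at hint
  simp only [Real.one_rpow, Complex.ofReal_one, one_mul, Complex.ofReal_zero, zero_mul,
    sub_zero] at hint
  have hv1 : v ^ ((A + 1 : ℝ) : ℂ) = v ^ (A : ℂ) * v := by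
    push_cast; rw [Complex.cpow_add _ _ hv0, Complex.cpow_one]
  rw [← hint, hv1]; ring

/-- The boundary values of `betaPrimitive` at `-1`. -/
lemma exists_tendsto_betaPrimitive {A B : ℝ} (hA : 0 < A) (hB : 0 < B) :
    ∃ c : ℂ, c ≠ 0 ∧
      Tendsto (betaPrimitive A B) (𝓝[{z | 0 < z.im}] (-1))
        (𝓝 (Complex.exp (Real.pi * Complex.I * (A + 1)) * c)) ∧
      Tendsto (betaPrimitive A B) (𝓝[{z | z.im < 0}] (-1))
        (𝓝 (Complex.exp (-(Real.pi * Complex.I * (A + 1))) * c)) := by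
  set f : ℝ → ℝ := fun u => u ^ A * (1 - u) ^ B
  have hAc : Continuous fun u : ℝ => u ^ A := Real.continuous_rpow_const hA.le
  have hf : Continuous f := hAc.mul
    ((Real.continuous_rpow_const hB.le).comp (continuous_const.sub continuous_id))
  have hpos : 0 < ∫ u in (0 : ℝ)..1, f u :=
    intervalIntegral.intervalIntegral_pos_of_pos_on (hf.intervalIntegrable _ _) (fun u hu =>
      mul_pos (Real.rpow_pos_of_pos hu.1 _) (Real.rpow_pos_of_pos (by linarith [hu.2]) _))
      zero_lt_one
  have hG : Tendsto (fun v : ℂ => ∫ u in (0 : ℝ)..1, ((u ^ A : ℝ) : ℂ) * (1 + u * v) ^ (B : ℂ))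
      (𝓝 (-1)) (𝓝 (∫ u in (0 : ℝ)..1, (f u : ℂ))) := by
    have hIoc : uIoc (0 : ℝ) 1 = Ioc 0 1 := uIoc_of_le zero_le_one
    refine intervalIntegral.tendsto_integral_filter_of_dominated_convergence (fun _ => 3 ^ B)
      ?_ ?_ intervalIntegrable_const ?_
    · refine .of_forall fun v => ?_
      have : Measurable fun u : ℝ => ((u ^ A : ℝ) : ℂ) * (1 + u * v) ^ (B : ℂ) := by fun_prop
      exact this.aestronglyMeasurable
    · filter_upwards [Metric.ball_mem_nhds (-1 : ℂ) one_pos] with v hv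
      refine .of_forall fun u hu => ?_
      rw [hIoc] at hu
      have hv2 : ‖v‖ ≤ 2 := by
        have h1 : ‖v - (-1)‖ < 1 := by simpa [dist_eq_norm] using hv
        have h2 : ‖v‖ ≤ ‖v - (-1)‖ + ‖(-1 : ℂ)‖ := by
          simpa using norm_add_le (v - (-1)) (-1)
        simp only [norm_neg, norm_one] at h2
        linarith
      rw [norm_mul, Complex.norm_cpow_real, Complex.norm_real, Real.norm_of_nonneg
        (Real.rpow_nonneg hu.1.le _)]
      have h1 : u ^ A ≤ 1 := Real.rpow_le_one hu.1.le hu.2 hA.le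
      have h2 : ‖1 + (u : ℂ) * v‖ ≤ 3 := by
        refine (norm_add_le _ _).trans ?_
        rw [norm_mul, Complex.norm_real, Real.norm_of_nonneg hu.1.le, norm_one]
        nlinarith [hu.2, hu.1, norm_nonneg v]
      have h3 := Real.rpow_le_rpow (norm_nonneg _) h2 hB.le
      calc _ ≤ 1 * (3 : ℝ) ^ B := by gcongr
        _ = _ := one_mul _
    · have h1 : ∀ᵐ u : ℝ, u ≠ 1 := by simp [ae_iff]
      filter_upwards [h1] with u hu1 hu
      rw [hIoc] at hu
      have hlt : 0 < 1 - u := sub_pos.mpr (lt_of_le_of_ne hu.2 hu1)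
      have e : (f u : ℂ) = ((u ^ A : ℝ) : ℂ) * (1 + (u : ℂ) * (-1)) ^ (B : ℂ) := by
        have : (1 + (u : ℂ) * (-1)) = ((1 - u : ℝ) : ℂ) := by push_cast; ring
        rw [this, ← Complex.ofReal_cpow hlt.le, ← Complex.ofReal_mul]
      rw [e]
      refine tendsto_const_nhds.mul (Tendsto.cpow ?_ tendsto_const_nhds ?_)
      · exact ((continuous_const.add (continuous_const.mul continuous_id)).tendsto (-1 : ℂ))
      · rw [show (1 + (u : ℂ) * (-1)) = ((1 - u : ℝ) : ℂ) by push_cast; ring]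
        exact Complex.ofReal_mem_slitPlane.mpr hlt
  -- The integral factor is continuous at -1, with the positive beta integral as limit; only v^(A+1)
  -- depends on the side of approach.
  refine ⟨∫ u in (0 : ℝ)..1, (f u : ℂ), ?_, ?_, ?_⟩
  · rw [intervalIntegral.integral_ofReal]
    exact_mod_cast hpos.ne'
  · refine Tendsto.mul ?_ (hG.mono_left nhdsWithin_le_nhds)
    have h1 := (Complex.tendsto_log_nhdsWithin_im_nonneg_of_re_neg_of_im_zero (z := -1)
      (by simp) (by simp)).mono_left (nhdsWithin_mono _ (fun z (hz : 0 < z.im) => hz.le))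
    have h2 := ((h1.mul_const (((A + 1 : ℝ) : ℂ))).cexp)
    simp only [norm_neg, norm_one, Real.log_one, Complex.ofReal_zero, zero_add] at h2
    push_cast at h2 ⊢
    refine h2.congr' ?_
    filter_upwards [self_mem_nhdsWithin] with z hz
    rw [Complex.cpow_def_of_ne_zero]
    rintro rfl
    exact lt_irrefl _ (show (0 : ℝ) < 0 from hz)
  · refine Tendsto.mul ?_ (hG.mono_left nhdsWithin_le_nhds)
    have h1 := (Complex.tendsto_log_nhdsWithin_im_neg_of_re_neg_of_im_zero (z := -1)
      (by simp) (by simp))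
    have h2 := ((h1.mul_const (((A + 1 : ℝ) : ℂ))).cexp)
    simp only [norm_neg, norm_one, Real.log_one, Complex.ofReal_zero, zero_sub, neg_mul] at h2
    push_cast at h2 ⊢
    refine h2.congr' ?_
    filter_upwards [self_mem_nhdsWithin] with z hz
    rw [Complex.cpow_def_of_ne_zero]
    rintro rfl
    exact lt_irrefl _ (show (0 : ℝ) < 0 from hz)

/-- The integral of `v^A (1 + v)^B` along a curve in the slit plane from `-1 + i0` to `-1 - i0`
does not vanish. -/
lemma IsExhausted.integral_cpow_ne_zero {I : Set ℝ} {l₁ l₂ : Filter ℝ} (hI : IsExhausted I l₁ l₂)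
    {A B : ℝ} (hA : 0 < A) (hB : 0 < B) (hA' : NotInt A) {S : Finset ℝ} {η η' : ℝ → ℂ}
    (hc : ContinuousOn η I) (hs : ∀ s ∈ I, η s ∈ Complex.slitPlane)
    (hd : ∀ s ∈ I, s ∉ S → HasDerivAt η (η' s) s)
    (hint : IntegrableOn (fun s => η s ^ (A : ℂ) * (1 + η s) ^ (B : ℂ) * η' s) I)
    (h₁ : Tendsto η l₁ (𝓝[{z | 0 < z.im}] (-1))) (h₂ : Tendsto η l₂ (𝓝[{z | z.im < 0}] (-1))) :
    ∫ s in I, η s ^ (A : ℂ) * (1 + η s) ^ (B : ℂ) * η' s ≠ 0 := by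
  obtain ⟨c, hc0, t1, t2⟩ := exists_tendsto_betaPrimitive hA hB
  have hF : ∀ s ∈ I, HasDerivAt (betaPrimitive A B) _ (η s) := fun s h =>
    hasDerivAt_betaPrimitive (B := B) hA (hs s h)
  rw [hI.integral_eq (Φ := fun s => betaPrimitive A B (η s)) (S := S)
    (fun s h => (hF s h).continuousAt.comp_continuousWithinAt (hc s h))
    (fun s h hS => (hF s h).comp s (hd s h hS)) hint (t1.comp h₁) (t2.comp h₂), ← sub_mul]
  refine mul_ne_zero (sub_ne_zero.mpr fun h => ?_) hc0
  obtain ⟨n, hn⟩ := Complex.exp_eq_exp_iff_exists_int.mp h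
  have hpi : (Real.pi * Complex.I : ℂ) ≠ 0 := by simp [Real.pi_ne_zero]
  -- Equal phases would make 2πi(A + 1) an integer multiple of 2πi.
  have h2 : (Real.pi * Complex.I : ℂ) * (A + 1) = Real.pi * Complex.I * (-n) := by
    linear_combination (-1 / 2 : ℂ) * hn
  have h3 := mul_left_cancel₀ hpi h2
  refine hA' (-n - 1) ?_
  have h4 : (A : ℂ) = ((-n - 1 : ℝ) : ℂ) := by push_cast; linear_combination h3
  have h5 := Complex.ofReal_injective h4
  push_cast; exact h5

/-! ### Shifting, reflecting and rescaling branches and integrals. -/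

lemma IsWeightBranch.mul_zpow {α β : ℝ} {I : Set ℝ} {γ W : ℝ → ℂ} (hγ : ContinuousOn γ I)
    (hW : IsWeightBranch α β I γ W) (j k : ℤ) :
    IsWeightBranch (α + j) (β + k) I γ fun s => (1 - γ s) ^ j * (γ s + 1) ^ k * W s := by
  have h0 := fun s hs => ne_zero_of_mem_weightValues (hW.2 s hs)
  refine ⟨(((continuousOn_const.sub hγ).zpow₀ j fun s hs => .inl (h0 s hs).2.1).mul
    ((hγ.add continuousOn_const).zpow₀ k fun s hs => .inl (h0 s hs).2.2)).mul hW.1,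
    fun s hs => ?_⟩
  obtain ⟨l₁, l₂, h1, h2, h3⟩ := hW.2 s hs
  refine ⟨l₁, l₂, h1, h2, ?_⟩
  simp only [h3]
  rw [← h1, ← h2, ← Complex.exp_int_mul, ← Complex.exp_int_mul, ← Complex.exp_add,
    ← Complex.exp_add]
  congr 1; push_cast; ring

lemma IsWeightBranch.neg {α β : ℝ} {I : Set ℝ} {γ W : ℝ → ℂ} (hW : IsWeightBranch α β I γ W) :
    IsWeightBranch β α I (fun s => -γ s) W := by
  refine ⟨hW.1, fun s hs => ?_⟩
  obtain ⟨l₁, l₂, h1, h2, h3⟩ := hW.2 s hs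
  exact ⟨l₂, l₁, by rw [h2]; ring, by rw [h1]; ring, by rw [h3, add_comm]⟩

lemma HasContourIntegral.congr {I : Set ℝ} (hI : MeasurableSet I) {γ f g : ℝ → ℂ} {v : ℂ}
    (h : HasContourIntegral I γ f v) (hfg : ∀ s ∈ I, f s = g s) : HasContourIntegral I γ g v := by
  have e : EqOn (fun s => f s * deriv γ s) (fun s => g s * deriv γ s) I := fun s hs => by
    simp only [hfg s hs]
  exact ⟨h.1.congr_fun e hI, by rw [← setIntegral_congr_fun hI e]; exact h.2⟩

/-- Nonvanishing of an integral transfers between integrands that differ by a constant factor. -/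
lemma integral_ne_zero_of_eq_const_mul {I : Set ℝ} (hI : MeasurableSet I) {f g : ℝ → ℂ} {c : ℂ}
    (hc : c ≠ 0) (h : ∀ s ∈ I, f s = c * g s) (hf : IntegrableOn f I)
    (hg : IntegrableOn g I → ∫ s in I, g s ≠ 0) : ∫ s in I, f s ≠ 0 := by
  rw [setIntegral_congr_fun hI h, integral_const_mul]
  refine mul_ne_zero hc (hg ?_)
  refine IntegrableOn.congr_fun (hf.const_mul c⁻¹) (fun s hs => ?_) hI
  simp only [h s hs, inv_mul_cancel_left₀ hc]

/-! ### The contours Γ₋₁. -/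

section GammaNegOne

variable {γ W : ℝ → ℂ} {α β : ℝ}

lemma IsContourAt.tendsto_start {a : ℂ} (hγ : IsContourAt a γ) : Tendsto γ (𝓝[>] 0) (𝓝 a) := by
  have := (hγ.continuousOn 0 (left_mem_Icc.mpr zero_le_one)).mono_of_mem_nhdsWithin
    (Icc_mem_nhdsGT zero_lt_one)
  simpa [hγ.start_eq] using this.tendsto

lemma IsContourAt.tendsto_end {a : ℂ} (hγ : IsContourAt a γ) : Tendsto γ (𝓝[<] 1) (𝓝 a) := by
  have := (hγ.continuousOn 1 (right_mem_Icc.mpr zero_le_one)).mono_of_mem_nhdsWithin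
    (Icc_mem_nhdsLT zero_lt_one)
  simpa [hγ.end_eq] using this.tendsto

lemma IsGammaNegOne.one_sub_ne_zero (hγ : IsGammaNegOne γ) {s : ℝ} (hs : s ∈ Icc (0 : ℝ) 1) :
    1 - γ s ≠ 0 := by
  rcases hs.1.eq_or_lt with rfl | h0
  · rw [hγ.contour.start_eq]; norm_num
  rcases hs.2.eq_or_lt with rfl | h1
  · rw [hγ.contour.end_eq]; norm_num
  intro h
  exact hγ.avoids s ⟨h0, h1⟩ ⟨1, le_refl (1 : ℝ), by
    rw [Complex.ofReal_one]; exact sub_eq_zero.mp h⟩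

/-- The closed curve stays away from 1, so all factors except the power of |t + 1| are continuous on
the compact parameter interval. -/
lemma IsGammaNegOne.integrableOn_weight (hγ : IsGammaNegOne γ) (α : ℝ) (hβ : -1 < β) (N : ℕ) :
    IntegrableOn (fun s => ‖1 - γ s‖ ^ α * ‖γ s + 1‖ ^ β * (1 + ‖γ s‖) ^ N * ‖deriv γ s‖)
      (Ioo 0 1) := by
  have h1 := hγ.contour.integrable_pow β hβ
  simp only [sub_neg_eq_add] at h1
  rw [← integrableOn_Icc_iff_integrableOn_Ioo] at h1 ⊢
  have hc : ContinuousOn (fun s => ‖1 - γ s‖ ^ α * (1 + ‖γ s‖) ^ N) (Icc 0 1) := by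
    have := hγ.contour.continuousOn
    exact ((continuousOn_const.sub this).norm.rpow_const fun s hs =>
      .inl (norm_ne_zero_iff.mpr (hγ.one_sub_ne_zero hs))).mul
        ((continuousOn_const.add this.norm).pow N)
  exact (h1.continuousOn_mul hc isCompact_Icc).congr_fun (fun s _ => by ring) measurableSet_Icc

lemma IsGammaNegOne.integral_ne_zero (hγ : IsGammaNegOne γ) (hα : 0 < α) (hβ : 0 < β)
    (hα' : NotInt α) (hW : IsWeightBranch α β (Ioo 0 1) γ W)
    (hint : IntegrableOn (fun s => W s * deriv γ s) (Ioo 0 1)) :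
    ∫ s in Ioo 0 1, W s * deriv γ s ≠ 0 := by
  obtain ⟨hcont, S, hS⟩ := hγ.contour.piecewiseC1
  -- This affine map fixes -1 and takes the complement of (-∞, 1] to the slit plane. With it, 1 - t
  -- = -2η and t + 1 = 2(1 + η), so p below is chosen as a logarithm of -2.
  set η : ℝ → ℂ := fun s => (γ s - 1) / 2
  have hηc : ContinuousOn η (Ioo 0 1) := (hcont.sub continuousOn_const).div_const _
  have hslit : ∀ s ∈ Ioo (0 : ℝ) 1, η s ∈ Complex.slitPlane := by
    intro s hs
    rw [Complex.mem_slitPlane_iff]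
    by_contra! h
    refine hγ.avoids s hs ⟨(γ s).re, ?_, ?_⟩
    · have h1 := h.1
      simp only [η, Complex.div_ofNat_re, Complex.sub_re, Complex.one_re] at h1
      simp only [mem_Iic]
      linarith
    · have h2 := h.2
      simp only [η, Complex.div_ofNat_im, Complex.sub_im, Complex.one_im] at h2
      apply Complex.ext
      · simp
      · simp only [Complex.ofReal_im]; linarith
  have hslit' : ∀ s ∈ Ioo (0 : ℝ) 1, 1 + η s ∈ Complex.slitPlane := fun s hs => by
    simpa using one_add_mul_mem_slitPlane (hslit s hs) zero_le_one
  set p : ℂ := Complex.log 2 + Real.pi * Complex.I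
  have hp : Complex.exp p = -2 := by
    rw [Complex.exp_add, Complex.exp_pi_mul_I, Complex.exp_log two_ne_zero]; ring
  have hV : IsWeightBranch α β (Ioo 0 1) γ fun s => Complex.exp
      (α * (Complex.log (η s) + p) + β * (Complex.log (1 + η s) + Complex.log 2)) := by
    refine isWeightBranch_of_log ((hηc.clog hslit).add continuousOn_const)
      (((continuousOn_const.add hηc).clog hslit').add continuousOn_const) (fun s hs => ?_)
      (fun s hs => ?_)
    · rw [Complex.exp_add, Complex.exp_log (Complex.slitPlane_ne_zero (hslit s hs)), hp]
      simp only [η]; ring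
    · rw [Complex.exp_add, Complex.exp_log (Complex.slitPlane_ne_zero (hslit' s hs)),
        Complex.exp_log two_ne_zero]
      simp only [η]; ring
  obtain ⟨c, hc, hWV⟩ := hW.eq_const_mul isPreconnected_Ioo ⟨1 / 2, by norm_num⟩ hV
  refine integral_ne_zero_of_eq_const_mul measurableSet_Ioo
    (g := fun s => η s ^ (α : ℂ) * (1 + η s) ^ (β : ℂ) * (deriv γ s / 2))
    (c := 2 * c * Complex.exp (α * p + β * Complex.log 2)) (by simp [hc]) (fun s hs => ?_) hint
    fun hg => ?_
  · rw [hWV s hs, Complex.cpow_def_of_ne_zero (Complex.slitPlane_ne_zero (hslit s hs)),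
      Complex.cpow_def_of_ne_zero (Complex.slitPlane_ne_zero (hslit' s hs))]
    have : α * (Complex.log (η s) + p) + β * (Complex.log (1 + η s) + Complex.log 2) =
      Complex.log (η s) * α + Complex.log (1 + η s) * β + (α * p + β * Complex.log 2) := by ring
    rw [this, Complex.exp_add, Complex.exp_add]; ring
  · have hη : ∀ l : Filter ℝ, Tendsto γ l (𝓝 (-1)) → Tendsto η l (𝓝 (-1)) := fun l h => by
      have := (h.sub_const 1).div_const 2
      norm_num at this
      exact this
    refine (isExhausted_Ioo one_pos).integral_cpow_ne_zero hα hβ hα' (S := S) hηc hslit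
      (fun s hs hsS => ?_) hg ?_ ?_
    · exact (((hS s hs hsS).differentiableAt (by norm_num)).hasDerivAt.sub_const 1).div_const 2
    · refine tendsto_nhdsWithin_iff.mpr ⟨hη _ hγ.contour.tendsto_start, ?_⟩
      filter_upwards [hγ.start_side] with s hs
      simpa [η] using hs
    · refine tendsto_nhdsWithin_iff.mpr ⟨hη _ hγ.contour.tendsto_end, ?_⟩
      filter_upwards [hγ.end_side] with s hs
      simp only [η, Complex.div_ofNat_im, Complex.sub_im, Complex.one_im]
      linarith

lemma IsGammaNegOne.hasContourIntegral (hγ : IsGammaNegOne γ) (hα : NotInt α)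
    (hαβ : NotInt (α + β)) (hβ1 : -1 < β)
    (hW : IsWeightBranch α β (Ioo 0 1) γ W) :
    ∃ c : ℂ, c ≠ 0 ∧ ∀ Q : ℂ[X], HasContourIntegral (Ioo 0 1) γ (fun s => Q.eval (γ s) * W s)
      (c * jacobiFunctional α β Q) := by
  have hC := hγ.contour.continuousOn
  have hbd : ∀ (a : ℝ) (k : ℕ) (l : Filter ℝ), Tendsto γ l (𝓝 (-1)) → Tendsto
      (fun s => ‖1 - γ s‖ ^ a * ‖γ s + 1‖ ^ (β + 1) * (1 + ‖γ s‖) ^ k) l (𝓝 0) := by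
    intro a k l h
    have h1 : Tendsto (fun s => ‖1 - γ s‖ ^ a) l (𝓝 (‖1 - (-1 : ℂ)‖ ^ a)) :=
      (tendsto_const_nhds.sub h).norm.rpow_const (.inl (by norm_num))
    have h2 : Tendsto (fun s => ‖γ s + 1‖ ^ (β + 1)) l (𝓝 (‖(-1 : ℂ) + 1‖ ^ (β + 1))) :=
      (h.add_const 1).norm.rpow_const (.inr (by linarith))
    have h3 := (h1.mul h2).mul ((h.norm.const_add 1).pow k)
    have h4 : ‖(-1 : ℂ) + 1‖ ^ (β + 1) = 0 := by
      rw [neg_add_cancel, norm_zero, Real.zero_rpow (by linarith)]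
    rw [h4, mul_zero, zero_mul] at h3
    exact h3
  have main : ∀ Q : ℂ[X], HasContourIntegral (Ioo 0 1) γ (fun s => Q.eval (γ s) * W s)
      ((∫ s in Ioo 0 1, W s * deriv γ s) * jacobiFunctional α β Q) := fun Q =>
    (isExhausted_Ioo one_pos).hasContourIntegral hγ.contour.piecewiseC1 hW hαβ
      (hγ.integrableOn_weight α hβ1 Q.natDegree) (Ioo_mem_nhdsGT one_pos) (Ioo_mem_nhdsLT one_pos)
      (fun k _ => hbd _ k _ hγ.contour.tendsto_start) (fun k _ => hbd _ k _ hγ.contour.tendsto_end)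
      le_rfl
  refine ⟨_, fun h0 => ?_, main⟩
  -- If the weight had integral 0, every polynomial would. Testing (1 - X)^j (X + 1) contradicts
  -- this, since it makes both exponents positive.
  obtain ⟨j, hj⟩ := exists_nat_gt (-α)
  have hW' := hW.mul_zpow hγ.contour.piecewiseC1.1 (j : ℤ) 1
  have hQ := (main ((1 - X) ^ j * (X + 1))).congr measurableSet_Ioo (g := fun s =>
    (1 - γ s) ^ (j : ℤ) * (γ s + 1) ^ (1 : ℤ) * W s) (fun s _ => by simp)
  refine hγ.integral_ne_zero (by push_cast; linarith) (by push_cast; linarith)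
    (hα.add_intCast j) hW' hQ.1 ?_
  rw [hQ.2, h0, zero_mul]

end GammaNegOne

/-! ### The contours Γ₁, by the reflection t ↦ -t. -/

section GammaOne

variable {γ W : ℝ → ℂ} {α β : ℝ}

lemma deriv_neg_fun (γ : ℝ → ℂ) (s : ℝ) : deriv (fun s => -γ s) s = -deriv γ s := by
  simp

lemma HasContourIntegral.neg {I : Set ℝ} {f : ℝ → ℂ} {v : ℂ}
    (h : HasContourIntegral I (fun s => -γ s) f v) : HasContourIntegral I γ f (-v) := by
  obtain ⟨h1, h2⟩ := h
  simp only [deriv_neg_fun, mul_neg] at h1 h2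
  rw [integral_neg] at h2
  exact ⟨by simpa using h1.neg, by rw [← h2, neg_neg]⟩

lemma IsPiecewiseC1.neg {I : Set ℝ} (h : IsPiecewiseC1 I γ) : IsPiecewiseC1 I fun s => -γ s :=
  ⟨h.1.neg, h.2.imp fun _ hS s hs hsS => (hS s hs hsS).neg⟩

lemma IsGammaOne.neg (hγ : IsGammaOne γ) : IsGammaNegOne fun s => -γ s where
  contour :=
    { start_eq := by rw [hγ.contour.start_eq]
      end_eq := by rw [hγ.contour.end_eq]
      piecewiseC1 := hγ.contour.piecewiseC1.neg
      continuousOn := hγ.contour.continuousOn.neg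
      integrable_pow := fun c hc => by
        have := hγ.contour.integrable_pow c hc
        have e : ∀ s, ‖-γ s - -1‖ = ‖γ s - 1‖ := fun s => by
          rw [← norm_neg]; congr 1; ring
        simpa only [deriv_neg_fun, norm_neg, e] using this }
  avoids := by
    rintro s hs ⟨x, hx, h⟩
    refine hγ.avoids s hs ⟨-x, neg_le_neg (a := x) (b := 1) hx, ?_⟩
    rw [Complex.ofReal_neg, h, neg_neg]
  start_side := by filter_upwards [hγ.start_side] with s hs; simpa using hs
  end_side := by filter_upwards [hγ.end_side] with s hs; simpa using hs

lemma IsGammaOne.hasContourIntegral (hγ : IsGammaOne γ)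
    (hαβ : NotInt (α + β)) (hβ : NotInt β) (hα1 : -1 < α)
    (hW : IsWeightBranch α β (Ioo 0 1) γ W) :
    ∃ c : ℂ, c ≠ 0 ∧ ∀ Q : ℂ[X], HasContourIntegral (Ioo 0 1) γ (fun s => Q.eval (γ s) * W s)
      (c * jacobiFunctional α β Q) := by
  obtain ⟨c, hc, H⟩ := hγ.neg.hasContourIntegral hβ (by rwa [add_comm]) hα1 hW.neg
  refine ⟨-c, neg_ne_zero.mpr hc, fun Q => ?_⟩
  have := (H (Q.comp (-X))).neg
  rw [jacobiFunctional_comp_neg_X (by rwa [add_comm])] at this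
  simpa using this

end GammaOne

/-! ### The contours Γ_∞. -/

section GammaInfty

lemma Real.rpow_le_mul_rpow {δ x y : ℝ} (hδ : 0 < δ) (hy : 0 < y) (h1 : δ * y ≤ x)
    (h2 : x ≤ 2 * y) (a : ℝ) : x ^ a ≤ (δ ^ a + 2 ^ a) * y ^ a := by
  have hδa := Real.rpow_nonneg hδ.le a
  have h2a : (0 : ℝ) ≤ 2 ^ a := by positivity
  have hya := Real.rpow_nonneg hy.le a
  rcases le_total 0 a with ha | ha
  · calc x ^ a ≤ (2 * y) ^ a := Real.rpow_le_rpow ((by positivity : 0 ≤ δ * y).trans h1) h2 ha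
      _ = 2 ^ a * y ^ a := Real.mul_rpow (by norm_num) hy.le
      _ ≤ _ := by gcongr; linarith
  · calc x ^ a ≤ (δ * y) ^ a := Real.rpow_le_rpow_of_nonpos (by positivity) h1 ha
      _ = δ ^ a * y ^ a := Real.mul_rpow hδ.le hy.le
      _ ≤ _ := by gcongr; linarith

variable {γ W : ℝ → ℂ} {α β : ℝ}

/-- Far out the bound holds with 1/2 by the triangle inequality; on the remaining compact parameter
interval a continuous positive quotient attains its minimum. -/
lemma exists_mul_one_add_norm_le (hγ : Continuous γ)
    (h1 : Tendsto γ atBot (Bornology.cobounded ℂ)) (h2 : Tendsto γ atTop (Bornology.cobounded ℂ))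
    {e : ℂ} (he : ‖e‖ = 1) (hne : ∀ s, γ s ≠ e) :
    ∃ δ : ℝ, 0 < δ ∧ ∀ s, δ * (1 + ‖γ s‖) ≤ ‖γ s - e‖ := by
  obtain ⟨a, ha⟩ := eventually_atBot.mp
    ((tendsto_norm_cobounded_atTop.comp h1).eventually_ge_atTop 3)
  obtain ⟨b, hb⟩ := eventually_atTop.mp
    ((tendsto_norm_cobounded_atTop.comp h2).eventually_ge_atTop 3)
  have hfar : ∀ s, 3 ≤ ‖γ s‖ → 1 / 2 * (1 + ‖γ s‖) ≤ ‖γ s - e‖ := fun s hs => by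
    have := norm_sub_norm_le (γ s) e
    rw [he] at this
    linarith
  set h : ℝ → ℝ := fun s => ‖γ s - e‖ / (1 + ‖γ s‖)
  have hpos : ∀ s, 0 < 1 + ‖γ s‖ := fun s => by positivity
  have hc : Continuous h := (hγ.sub continuous_const).norm.div (continuous_const.add hγ.norm)
    fun s => (hpos s).ne'
  have hh : ∀ s, 0 < h s := fun s =>
    div_pos (norm_pos_iff.mpr (sub_ne_zero.mpr (hne s))) (hpos s)
  obtain ⟨s₀, -, hs₀⟩ := (isCompact_uIcc (a := a) (b := b)).exists_isMinOn nonempty_uIcc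
    hc.continuousOn
  refine ⟨min (1 / 2) (h s₀), lt_min (by norm_num) (hh s₀), fun s => ?_⟩
  by_cases hs : s ∈ uIcc a b
  · calc _ ≤ h s * (1 + ‖γ s‖) := by
          gcongr
          exact (min_le_right _ _).trans (hs₀ hs)
      _ = _ := div_mul_cancel₀ _ (hpos s).ne'
  · have h3 : 3 ≤ ‖γ s‖ := by
      rw [mem_uIcc, not_or] at hs
      rcases le_or_gt s a with h | h
      · exact ha s h
      · refine hb s ?_
        by_contra! h'
        exact hs.1 ⟨h.le, h'.le⟩
    refine le_trans ?_ (hfar s h3)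
    gcongr
    exact min_le_left _ _

lemma IsGammaInfty.exists_weight_le (hγ : IsGammaInfty γ) (α β : ℝ) :
    ∃ K : ℝ, 0 ≤ K ∧ ∀ s, ‖1 - γ s‖ ^ α * ‖γ s + 1‖ ^ β ≤ K * (1 + ‖γ s‖) ^ (α + β) := by
  have hc : Continuous γ := continuousOn_univ.mp hγ.piecewiseC1.1
  obtain ⟨δ, hδ, h1⟩ := exists_mul_one_add_norm_le hc hγ.tendsto_start hγ.tendsto_end
    (e := 1) (by simp) (fun s h => hγ.avoids s ⟨1, .inr (le_refl (1 : ℝ)), by simp [h]⟩)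
  obtain ⟨ε, hε, h2⟩ := exists_mul_one_add_norm_le hc hγ.tendsto_start hγ.tendsto_end
    (e := -1) (by simp) (fun s h => hγ.avoids s ⟨-1, .inl (le_refl (-1 : ℝ)), by simp [h]⟩)
  refine ⟨(δ ^ α + 2 ^ α) * (ε ^ β + 2 ^ β), by positivity, fun s => ?_⟩
  have hpos : 0 < 1 + ‖γ s‖ := by positivity
  have u1 : ‖1 - γ s‖ ^ α ≤ _ := Real.rpow_le_mul_rpow hδ hpos (by
    rw [norm_sub_rev]; exact h1 s) (by
      have := norm_sub_le 1 (γ s); rw [norm_one] at this; linarith [norm_nonneg (γ s)]) α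
  have u2 : ‖γ s + 1‖ ^ β ≤ _ := Real.rpow_le_mul_rpow hε hpos (by
    simpa using h2 s) (by
      have := norm_add_le (γ s) 1; rw [norm_one] at this; linarith [norm_nonneg (γ s)]) β
  rw [Real.rpow_add hpos]
  calc _ ≤ ((δ ^ α + 2 ^ α) * (1 + ‖γ s‖) ^ α) * ((ε ^ β + 2 ^ β) * (1 + ‖γ s‖) ^ β) := by gcongr
    _ = _ := by ring

lemma IsGammaInfty.integral_ne_zero_of_pos (hγ : IsGammaInfty γ) (hβ : 0 < β)
    (hαβ2 : α + β < -2) (hβ' : NotInt β) (hW : IsWeightBranch α β univ γ W)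
    (hint : IntegrableOn (fun s => W s * deriv γ s) univ) :
    ∫ s in univ, W s * deriv γ s ≠ 0 := by
  obtain ⟨hcont, S, hS⟩ := hγ.piecewiseC1
  have hne : ∀ s ∈ univ, 1 - γ s ≠ 0 := fun s hs =>
    (ne_zero_of_mem_weightValues (hW.2 s hs)).2.1
  -- This Möbius map takes the doubly cut plane into the slit plane and infinity to -1, preserving
  -- the sign of the imaginary part; Γ_∞ becomes a curve from -1 + i0 to -1 - i0.
  set η : ℝ → ℂ := fun s => (1 + γ s) / (1 - γ s)
  have hη1 : ∀ s, 1 + η s = 2 / (1 - γ s) := fun s => by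
    have := hne s trivial
    simp only [η]; field_simp; ring
  have hηc : ContinuousOn η univ :=
    (continuousOn_const.add hcont).div (continuousOn_const.sub hcont) hne
  have hslit : ∀ s ∈ univ, η s ∈ Complex.slitPlane := by
    intro s hs
    rw [Complex.mem_slitPlane_iff]
    by_contra! h
    set r := (η s).re with hr
    have hr' : η s = (r : ℂ) := Complex.ext (by simp [hr]) (by simp [h.2])
    have h1 := hη1 s
    rw [hr', eq_div_iff (hne s hs)] at h1
    have h2 : (1 + r : ℝ) ≠ 0 := by
      intro h3
      have h3' : (1 + r : ℂ) = 0 := by exact_mod_cast h3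
      rw [h3', zero_mul] at h1
      exact two_ne_zero h1.symm
    have h2' : (1 + r : ℂ) ≠ 0 := by exact_mod_cast h2
    -- The preimage of a value r ≤ 0, r ≠ -1; it lies on one of the two cuts.
    refine hγ.avoids s ⟨(r - 1) / (1 + r), ?_, ?_⟩
    · rcases lt_or_gt_of_ne h2 with h3 | h3
      · right
        rw [mem_Ici, le_div_iff_of_neg h3]; linarith
      · left
        rw [mem_Iic, div_le_iff₀ h3]; linarith [h.1]
    · push_cast
      rw [div_eq_iff h2']
      linear_combination h1
  have hslit' : ∀ s ∈ univ, 1 + η s ∈ Complex.slitPlane := fun s hs => by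
    simpa using one_add_mul_mem_slitPlane (hslit s hs) zero_le_one
  have hV : IsWeightBranch α β univ γ fun s => Complex.exp (α * (Complex.log 2 -
      Complex.log (1 + η s)) + β * (Complex.log (η s) +
        (Complex.log 2 - Complex.log (1 + η s)))) := by
    have c1 := (hηc.clog hslit)
    have c2 := ((continuousOn_const (c := (1 : ℂ))).add hηc).clog hslit'
    have e1 : ∀ s ∈ univ, Complex.exp (Complex.log 2 - Complex.log (1 + η s)) = 1 - γ s := by
      intro s hs
      rw [Complex.exp_sub, Complex.exp_log two_ne_zero,
        Complex.exp_log (Complex.slitPlane_ne_zero (hslit' s hs)), hη1, div_div_cancel₀ two_ne_zero]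
    refine isWeightBranch_of_log (continuousOn_const.sub c2)
      (c1.add (continuousOn_const.sub c2)) e1 (fun s hs => ?_)
    rw [Complex.exp_add, e1 s hs, Complex.exp_log (Complex.slitPlane_ne_zero (hslit s hs)),
      div_mul_cancel₀ _ (hne s hs), add_comm]
  obtain ⟨c, hc, hWV⟩ := hW.eq_const_mul isPreconnected_univ univ_nonempty hV
  -- Since 1 - t = 2/(1 + η), t + 1 = 2η/(1 + η) and dη = 2 dt/(1 - t)², the exponent of 1 + η is -α
  -- - β - 2, positive by assumption.
  refine integral_ne_zero_of_eq_const_mul MeasurableSet.univ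
    (g := fun s => η s ^ (β : ℂ) * (1 + η s) ^ ((-α - β - 2 : ℝ) : ℂ) *
      (2 * deriv γ s / (1 - γ s) ^ 2))
    (c := 2 * c * Complex.exp ((α + β) * Complex.log 2)) (by simp [hc]) (fun s hs => ?_) hint
    fun hg => ?_
  · have hn := Complex.slitPlane_ne_zero (hslit' s hs)
    rw [hWV s hs, Complex.cpow_def_of_ne_zero (Complex.slitPlane_ne_zero (hslit s hs)),
      Complex.cpow_def_of_ne_zero hn]
    have e1 : α * (Complex.log 2 - Complex.log (1 + η s)) + β * (Complex.log (η s) +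
        (Complex.log 2 - Complex.log (1 + η s))) = (α + β) * Complex.log 2 +
        Complex.log (η s) * β + Complex.log (1 + η s) * ((-α - β - 2 : ℝ) : ℂ) +
          2 * Complex.log (1 + η s) := by push_cast; ring
    have e2 : Complex.exp (2 * Complex.log (1 + η s)) = (2 / (1 - γ s)) ^ 2 := by
      rw [two_mul, Complex.exp_add, Complex.exp_log hn, hη1, sq]
    rw [e1, Complex.exp_add, Complex.exp_add, Complex.exp_add, e2]
    field_simp
  · have hη : ∀ l : Filter ℝ, Tendsto γ l (Bornology.cobounded ℂ) → Tendsto η l (𝓝 (-1)) := by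
      intro l h
      have h1 : Tendsto (fun s => 1 - γ s) l (Bornology.cobounded ℂ) := by
        rw [← tendsto_norm_atTop_iff_cobounded] at h ⊢
        refine tendsto_atTop_mono (fun s => ?_) (tendsto_atTop_add_const_right _ (-1) h)
        have := norm_sub_norm_le (γ s) 1
        rw [norm_one] at this
        rw [norm_sub_rev]; linarith
      have h2 := ((tendsto_inv₀_cobounded.comp h1).const_mul 2).sub_const 1
      rw [mul_zero, zero_sub] at h2
      refine h2.congr fun s => ?_
      have := hη1 s
      simp only [Function.comp]
      linear_combination -this
    have him : ∀ s, (η s).im = 2 * (γ s).im / Complex.normSq (1 - γ s) := fun s => by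
      have h1 : η s = 2 / (1 - γ s) - 1 := by rw [← hη1]; ring
      rw [h1]
      simp [Complex.div_im]
      ring
    have hnorm : ∀ s, 0 < Complex.normSq (1 - γ s) := fun s =>
      Complex.normSq_pos.mpr (hne s trivial)
    refine isExhausted_univ.integral_cpow_ne_zero hβ (by linarith) hβ' (S := S) hηc hslit
      (fun s hs hsS => ?_) hg ?_ ?_
    · have hd := ((hS s hs hsS).differentiableAt (by norm_num)).hasDerivAt
      refine ((hd.const_add 1).div (hd.const_sub 1) (hne s hs)).congr_deriv ?_
      congr 1; ring
    · refine tendsto_nhdsWithin_iff.mpr ⟨hη _ hγ.tendsto_start, ?_⟩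
      filter_upwards [hγ.start_side] with s hs
      rw [him]
      have := hnorm s
      positivity
    · refine tendsto_nhdsWithin_iff.mpr ⟨hη _ hγ.tendsto_end, ?_⟩
      filter_upwards [hγ.end_side] with s hs
      rw [him]
      exact div_neg_of_neg_of_pos (by linarith) (hnorm s)

/-- The weight is O((1 + |t|)^(α+β)) along the curve, so the degree bound gives both convergence and
vanishing boundary terms. -/
lemma IsGammaInfty.hasContourIntegral_of_degree (hγ : IsGammaInfty γ) (hαβ : NotInt (α + β))
    (hW : IsWeightBranch α β univ γ W) {Q : ℂ[X]} (hQ : Q.natDegree + α + β < -1) :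
    HasContourIntegral univ γ (fun s => Q.eval (γ s) * W s)
      ((∫ s in univ, W s * deriv γ s) * jacobiFunctional α β Q) := by
  have hpos : ∀ s, 0 < 1 + ‖γ s‖ := fun s => by positivity
  have hbd : ∀ l : Filter ℝ, Tendsto γ l (Bornology.cobounded ℂ) → ∀ k < Q.natDegree, Tendsto
      (fun s => ‖1 - γ s‖ ^ (α + 1) * ‖γ s + 1‖ ^ (β + 1) * (1 + ‖γ s‖) ^ k) l (𝓝 0) := by
    intro l h k hk
    obtain ⟨K, hK, hle⟩ := hγ.exists_weight_le (α + 1) (β + 1)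
    have hk' : (k : ℝ) + 1 ≤ Q.natDegree := by exact_mod_cast hk
    have ht : Tendsto (fun s => 1 + ‖γ s‖) l atTop :=
      tendsto_atTop_add_const_left _ _ (tendsto_norm_cobounded_atTop.comp h)
    have h1 := ((tendsto_rpow_neg_atTop (y := -(α + 1 + (β + 1) + k)) (by linarith)).comp
      ht).const_mul K
    rw [mul_zero] at h1
    refine squeeze_zero (fun s => by positivity) (fun s => ?_) h1
    simp only [Function.comp, neg_neg]
    rw [Real.rpow_add_natCast (hpos s).ne', ← mul_assoc]
    exact mul_le_mul_of_nonneg_right (hle s) (by positivity)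
  refine isExhausted_univ.hasContourIntegral hγ.piecewiseC1 hW hαβ (N := Q.natDegree) ?_
    (.of_forall fun _ => trivial) (.of_forall fun _ => trivial) (hbd _ hγ.tendsto_start)
    (hbd _ hγ.tendsto_end) le_rfl
  obtain ⟨K, hK, hle⟩ := hγ.exists_weight_le α β
  have hc : Continuous γ := continuousOn_univ.mp hγ.piecewiseC1.1
  rw [integrableOn_univ]
  refine ((hγ.integrable_pow (α + β + Q.natDegree) (by linarith)).const_mul K).mono' ?_
    (.of_forall fun s => ?_)
  · have h1 : Measurable fun s => ‖1 - γ s‖ ^ α * ‖γ s + 1‖ ^ β * (1 + ‖γ s‖) ^ Q.natDegree := by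
      have := hc.measurable
      fun_prop
    exact (h1.mul (measurable_deriv γ).norm).aestronglyMeasurable
  · rw [Real.norm_of_nonneg (by positivity), Real.rpow_add_natCast (hpos s).ne', ← mul_assoc,
      ← mul_assoc]
    exact mul_le_mul_of_nonneg_right (mul_le_mul_of_nonneg_right (hle s) (by positivity))
      (by positivity)

/-- Induction on j > -β, raising β with α + β fixed until β is positive. The weights (α, β) and (α -
1, β + 1) are the weight (α - 1, β) times 1 - t and 1 + t. If the second has nonzero integral, so
has (α - 1, β); the nonzero value of the functional at 1 - X carries this over to (α, β). -/
lemma IsGammaInfty.integral_ne_zero (hγ : IsGammaInfty γ) (hα : NotInt α) (hβ : NotInt β)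
    (hαβ : NotInt (α + β)) (hαβ2 : α + β < -2) (hW : IsWeightBranch α β univ γ W) :
    ∫ s in univ, W s * deriv γ s ≠ 0 := by
  obtain ⟨j, hj⟩ := exists_nat_gt (-β)
  replace hj : -(j : ℝ) < β := by linarith
  induction j generalizing α β W with
  | zero =>
    refine hγ.integral_ne_zero_of_pos (by simpa using hj) hαβ2 hβ hW ?_
    have := (hγ.hasContourIntegral_of_degree hαβ hW (Q := 1) (by simp; linarith)).1
    simpa using this
  | succ j ih =>
    have hc := hγ.piecewiseC1.1
    have hW₁ := hW.mul_zpow hc (-1) 0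
    have hW₂ := hW.mul_zpow hc (-1) 1
    have hne : ∀ s, 1 - γ s ≠ 0 := fun s => (ne_zero_of_mem_weightValues (hW.2 s trivial)).2.1
    have hα₁ : NotInt (α + ((-1 : ℤ) : ℝ)) := hα.add_intCast (-1)
    have hs₁ : NotInt (α + ((-1 : ℤ) : ℝ) + (β + ((0 : ℤ) : ℝ))) := by
      have := hαβ.add_intCast (-1)
      convert this using 1; push_cast; ring
    have d1 : ((1 : ℂ[X]) + X).natDegree = 1 := by
      rw [add_comm]; exact natDegree_X_add_C (1 : ℂ)
    have d2 : ((1 : ℂ[X]) - X).natDegree = 1 := by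
      rw [← natDegree_neg, neg_sub]; exact natDegree_X_sub_C (1 : ℂ)
    have h₁ := hγ.hasContourIntegral_of_degree hs₁ hW₁ (Q := 1 + X) (by
      rw [d1]; push_cast; linarith)
    have h₂ := hγ.hasContourIntegral_of_degree hs₁ hW₁ (Q := 1 - X) (by
      rw [d2]; push_cast; linarith)
    have n2 := ih (α := α + ((-1 : ℤ) : ℝ)) (β := β + ((1 : ℤ) : ℝ)) hα₁ (hβ.add_intCast 1)
      (by convert hαβ using 1; push_cast; ring) (by push_cast; linarith) hW₂
      (by push_cast at hj ⊢; linarith)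
    have e₁ := (h₁.congr MeasurableSet.univ (g := fun s =>
      (1 - γ s) ^ (-1 : ℤ) * (γ s + 1) ^ (1 : ℤ) * W s) (fun s _ => by simp; ring)).2
    have e₂ := (h₂.congr MeasurableSet.univ (g := W) (fun s _ => by
      have := hne s
      simp; field_simp)).2
    rw [e₁] at n2
    rw [e₂]
    obtain ⟨d, hd, H⟩ := jacobiFunctional_one_sub_X_mul hs₁ hα₁
    have H1 := H 1
    rw [mul_one, jacobiFunctional_one, mul_one] at H1
    rw [H1]
    exact mul_ne_zero (left_ne_zero_of_mul n2) hd

end GammaInfty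

/-! ### The real intervals (-1, 1), (-∞, -1) and (1, ∞). -/

section RealIntervals

variable {W : ℝ → ℂ} {α β : ℝ}

lemma deriv_ofReal (s : ℝ) : deriv (fun t : ℝ => (t : ℂ)) s = 1 :=
  Complex.ofRealCLM.hasDerivAt.deriv

lemma isPiecewiseC1_ofReal (I : Set ℝ) : IsPiecewiseC1 I fun t : ℝ => (t : ℂ) :=
  ⟨Complex.continuous_ofReal.continuousOn, ∅, fun _ _ _ => Complex.ofRealCLM.contDiff.contDiffAt⟩

/-- On a real interval the weight has constant phase, so its integral does not vanish. -/
lemma integral_ofReal_branch_ne_zero {I : Set ℝ} {l₁ l₂ : Filter ℝ} (hI : IsExhausted I l₁ l₂)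
    {u v : ℝ → ℝ} {θ : ℂ} (hu : ContinuousOn u I) (hv : ContinuousOn v I)
    (e₁ : ∀ t ∈ I, Complex.exp (u t) = 1 - t) (e₂ : ∀ t ∈ I, Complex.exp (v t + θ) = t + 1)
    (hW : IsWeightBranch α β I (fun t => (t : ℂ)) W)
    (hint : IntegrableOn (fun s => W s * deriv (fun t : ℝ => (t : ℂ)) s) I) :
    ∫ s in I, W s * deriv (fun t : ℝ => (t : ℂ)) s ≠ 0 := by
  have hV : IsWeightBranch α β I (fun t => (t : ℂ)) fun t =>
      Complex.exp (α * (u t : ℂ) + β * (v t + θ)) :=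
    isWeightBranch_of_log (Complex.continuous_ofReal.comp_continuousOn hu)
      ((Complex.continuous_ofReal.comp_continuousOn hv).add continuousOn_const) e₁ e₂
  obtain ⟨c, hc, hWV⟩ := hW.eq_const_mul hI.ordConnected.isPreconnected hI.nonempty hV
  refine integral_ne_zero_of_eq_const_mul hI.isOpen.measurableSet
    (g := fun t => ((Real.exp (α * u t + β * v t) : ℝ) : ℂ)) (c := c * Complex.exp (β * θ))
    (by simp [hc]) (fun t ht => ?_) hint fun hg => ?_
  · rw [deriv_ofReal, mul_one, hWV t ht, mul_assoc, Complex.ofReal_exp, ← Complex.exp_add]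
    congr 2; push_cast; ring
  · rw [integral_complex_ofReal]
    have hpos : 0 < ∫ t in I, Real.exp (α * u t + β * v t) := by
      rw [setIntegral_pos_iff_support_of_nonneg_ae]
      · have : (Function.support fun t => Real.exp (α * u t + β * v t)) = univ := by
          ext t; simp
        rw [this, univ_inter]
        exact hI.isOpen.measure_pos volume hI.nonempty
      · exact .of_forall fun t => (Real.exp_pos _).le
      · exact hg.re
    exact_mod_cast hpos.ne'

lemma integrableOn_sub_rpow {r : ℝ} (hr : -1 < r) {c d : ℝ} (h : d < c) :
    IntegrableOn (fun t => (c - t) ^ r) (Ioo d c) := by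
  have := (intervalIntegral.intervalIntegrable_rpow' (a := 0) (b := c - d) hr).comp_sub_left c
  rw [sub_zero, sub_sub_cancel] at this
  exact (intervalIntegrable_iff_integrableOn_Ioo_of_le h.le).mp this.symm

lemma integrableOn_add_rpow {r : ℝ} (hr : -1 < r) {c d : ℝ} (h : -c < d) :
    IntegrableOn (fun t => (t + c) ^ r) (Ioo (-c) d) := by
  have := (intervalIntegral.intervalIntegrable_rpow' (a := 0) (b := d + c) hr).comp_add_right c
  rw [zero_sub, add_sub_cancel_right] at this
  exact (intervalIntegrable_iff_integrableOn_Ioo_of_le h.le).mp this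

lemma measurable_weight_ofReal (α β : ℝ) (N : ℕ) : Measurable fun s : ℝ =>
    ‖1 - (s : ℂ)‖ ^ α * ‖(s : ℂ) + 1‖ ^ β * (1 + ‖(s : ℂ)‖) ^ N *
      ‖deriv (fun t : ℝ => (t : ℂ)) s‖ := by
  simp only [deriv_ofReal]
  fun_prop

lemma integrableOn_weight_Ioo (hα : -1 < α) (hβ : -1 < β) (N : ℕ) :
    IntegrableOn (fun s : ℝ => ‖1 - (s : ℂ)‖ ^ α * ‖(s : ℂ) + 1‖ ^ β * (1 + ‖(s : ℂ)‖) ^ N *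
      ‖deriv (fun t : ℝ => (t : ℂ)) s‖) (Ioo (-1) 1) := by
  have h1 := integrableOn_sub_rpow hα (show (-1 : ℝ) < 1 by norm_num)
  have h2 := integrableOn_add_rpow hβ (show -(1 : ℝ) < 1 by norm_num)
  refine (((h1.const_mul (1 ^ β + 2 ^ β)).add (h2.const_mul (1 ^ α + 2 ^ α))).const_mul
    (2 ^ N)).mono' (measurable_weight_ofReal α β N).aestronglyMeasurable
    ((ae_restrict_iff' measurableSet_Ioo).mpr (.of_forall fun t ht => ?_))
  have n1 : ‖1 - (t : ℂ)‖ = 1 - t := by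
    rw [← Complex.ofReal_one, ← Complex.ofReal_sub, Complex.norm_real,
      Real.norm_of_nonneg (by linarith [ht.2])]
  have n2 : ‖(t : ℂ) + 1‖ = t + 1 := by
    rw [← Complex.ofReal_one, ← Complex.ofReal_add, Complex.norm_real,
      Real.norm_of_nonneg (by linarith [ht.1])]
  have n3 : ‖(t : ℂ)‖ ≤ 1 := by
    rw [Complex.norm_real, Real.norm_eq_abs, abs_le]; exact ⟨ht.1.le, ht.2.le⟩
  rw [Real.norm_of_nonneg (by positivity), deriv_ofReal, norm_one, mul_one, n1, n2, mul_comm]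
  have p1 : 0 ≤ (1 - t) ^ α := Real.rpow_nonneg (by linarith [ht.2]) _
  have p2 : 0 ≤ (t + 1) ^ β := Real.rpow_nonneg (by linarith [ht.1]) _
  have p3 : (1 + ‖(t : ℂ)‖) ^ N ≤ 2 ^ N := pow_le_pow_left₀ (by positivity) (by linarith) N
  -- On each half of the interval one factor lies between 1 and 2, so it is bounded whatever the
  -- sign of its exponent.
  have key : (1 - t) ^ α * (t + 1) ^ β ≤
      (1 ^ β + 2 ^ β) * (1 - t) ^ α + (1 ^ α + 2 ^ α) * (t + 1) ^ β := by
    rcases le_total 0 t with h | h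
    · have := Real.rpow_le_mul_rpow (x := t + 1) one_pos one_pos (by linarith)
        (by linarith [ht.2]) β
      rw [Real.one_rpow, mul_one] at this
      have q := mul_le_mul_of_nonneg_left this p1
      have : 0 ≤ (1 ^ α + 2 ^ α) * (t + 1) ^ β := by positivity
      simp only [Real.one_rpow] at *
      linarith
    · have := Real.rpow_le_mul_rpow (x := 1 - t) one_pos one_pos (by linarith)
        (by linarith [ht.1]) α
      rw [Real.one_rpow, mul_one] at this
      have q := mul_le_mul_of_nonneg_right this p2
      have : 0 ≤ (1 ^ β + 2 ^ β) * (1 - t) ^ α := by positivity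
      simp only [Real.one_rpow] at *
      linarith
  exact mul_le_mul p3 key (by positivity) (by positivity)

lemma exists_hasContourIntegral_Ioo (hα : -1 < α) (hβ : -1 < β) (hαβ : NotInt (α + β))
    (hW : IsWeightBranch α β (Ioo (-1) 1) (fun t => (t : ℂ)) W) :
    ∃ c : ℂ, c ≠ 0 ∧ ∀ Q : ℂ[X], HasContourIntegral (Ioo (-1) 1) (fun t => (t : ℂ))
      (fun s => Q.eval (s : ℂ) * W s) (c * jacobiFunctional α β Q) := by
  have hlt : (-1 : ℝ) < 1 := by norm_num
  have hbd : ∀ k : ℕ, Continuous fun s : ℝ =>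
      ‖1 - (s : ℂ)‖ ^ (α + 1) * ‖(s : ℂ) + 1‖ ^ (β + 1) * (1 + ‖(s : ℂ)‖) ^ k := fun k => by
    have h1 : Continuous fun s : ℝ => ‖1 - (s : ℂ)‖ ^ (α + 1) :=
      (by fun_prop : Continuous fun s : ℝ => ‖1 - (s : ℂ)‖).rpow_const
        fun _ => .inr (by linarith)
    have h2 : Continuous fun s : ℝ => ‖(s : ℂ) + 1‖ ^ (β + 1) :=
      (by fun_prop : Continuous fun s : ℝ => ‖(s : ℂ) + 1‖).rpow_const
        fun _ => .inr (by linarith)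
    fun_prop
  have z1 : (0 : ℝ) ^ (α + 1) = 0 := Real.zero_rpow (by linarith)
  have z2 : (0 : ℝ) ^ (β + 1) = 0 := Real.zero_rpow (by linarith)
  have main : ∀ Q : ℂ[X], HasContourIntegral (Ioo (-1) 1) (fun t => (t : ℂ))
      (fun s => Q.eval (s : ℂ) * W s) ((∫ s in Ioo (-1) 1, W s *
        deriv (fun t : ℝ => (t : ℂ)) s) * jacobiFunctional α β Q) := fun Q =>
    (isExhausted_Ioo hlt).hasContourIntegral (isPiecewiseC1_ofReal _) hW hαβ
      (integrableOn_weight_Ioo hα hβ Q.natDegree) (Ioo_mem_nhdsGT hlt) (Ioo_mem_nhdsLT hlt)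
      (fun k _ => by
        have := ((hbd k).tendsto (-1)).mono_left (nhdsWithin_le_nhds (s := Ioi (-1)))
        simpa [z2] using this)
      (fun k _ => by
        have := ((hbd k).tendsto 1).mono_left (nhdsWithin_le_nhds (s := Iio 1))
        simpa [z1] using this) le_rfl
  refine ⟨_, ?_, main⟩
  refine integral_ofReal_branch_ne_zero (isExhausted_Ioo hlt) (u := fun t => Real.log (1 - t))
    (v := fun t => Real.log (t + 1)) (θ := 0) ?_ ?_ ?_ ?_ hW (by simpa using (main 1).1)
  · exact ContinuousOn.log (by fun_prop) fun t ht => (by linarith [ht.2] : 0 < 1 - t).ne'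
  · exact ContinuousOn.log (by fun_prop) fun t ht => (by linarith [ht.1] : 0 < t + 1).ne'
  · intro t ht
    rw [← Complex.ofReal_exp, Real.exp_log (by linarith [ht.2])]; push_cast; rfl
  · intro t ht
    rw [add_zero, ← Complex.ofReal_exp, Real.exp_log (by linarith [ht.1])]; push_cast; rfl

lemma weight_ofReal_le_of_le_neg_two (α β : ℝ) {t : ℝ} (ht : t ≤ -2) :
    ‖1 - (t : ℂ)‖ ^ α * ‖(t : ℂ) + 1‖ ^ β ≤
      ((1 / 3) ^ β + 2 ^ β) * (1 + ‖(t : ℂ)‖) ^ (α + β) := by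
  have n1 : ‖1 - (t : ℂ)‖ = 1 - t := by
    rw [← Complex.ofReal_one, ← Complex.ofReal_sub, Complex.norm_real,
      Real.norm_of_nonneg (by linarith)]
  have n2 : ‖(t : ℂ) + 1‖ = -1 - t := by
    rw [← Complex.ofReal_one, ← Complex.ofReal_add, Complex.norm_real,
      Real.norm_of_nonpos (by linarith)]; ring
  have n3 : 1 + ‖(t : ℂ)‖ = 1 - t := by
    rw [Complex.norm_real, Real.norm_of_nonpos (by linarith)]; ring
  have hp : 0 < 1 - t := by linarith
  rw [n1, n2, n3, Real.rpow_add hp]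
  have := Real.rpow_le_mul_rpow (x := -1 - t) (δ := 1 / 3) (by norm_num) hp (by linarith)
    (by linarith) β
  calc _ ≤ (1 - t) ^ α * (((1 / 3) ^ β + 2 ^ β) * (1 - t) ^ β) := by gcongr
    _ = _ := by ring

/-- Split at -2: the degree bound controls the part at infinity, and β > -1 controls the singularity
at -1. -/
lemma integrableOn_weight_Iio (hβ : -1 < β) {N : ℕ} (hN : N + α + β < -1) :
    IntegrableOn (fun s : ℝ => ‖1 - (s : ℂ)‖ ^ α * ‖(s : ℂ) + 1‖ ^ β * (1 + ‖(s : ℂ)‖) ^ N *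
      ‖deriv (fun t : ℝ => (t : ℂ)) s‖) (Iio (-1)) := by
  have hsplit : Iio (-1 : ℝ) = Iic (-2) ∪ Ioo (-2) (-1) := by
    ext t; simp only [mem_Iio, mem_union, mem_Iic, mem_Ioo]
    constructor
    · intro h
      rcases le_or_gt t (-2) with h' | h'
      · exact .inl h'
      · exact .inr ⟨h', h⟩
    · rintro (h | h) <;> linarith
  rw [hsplit, integrableOn_union]
  constructor
  · have h1 : Integrable (fun t : ℝ => (1 + ‖t‖) ^ (α + β + N)) := by
      have := integrable_one_add_norm (E := ℝ) (μ := volume) (r := -(α + β + N)) (by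
        simp; linarith)
      simpa only [neg_neg] using this
    refine (h1.integrableOn.const_mul ((1 / 3) ^ β + 2 ^ β)).mono'
      (measurable_weight_ofReal α β N).aestronglyMeasurable
      ((ae_restrict_iff' measurableSet_Iic).mpr (.of_forall fun t ht => ?_))
    have hp : 0 < 1 + ‖t‖ := by positivity
    rw [Real.norm_of_nonneg (by positivity), deriv_ofReal, norm_one, mul_one,
      Real.rpow_add_natCast hp.ne', ← mul_assoc]
    have := weight_ofReal_le_of_le_neg_two α β ht
    rw [Complex.norm_real t] at *
    exact mul_le_mul_of_nonneg_right this (by positivity)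
  · have h1 := integrableOn_sub_rpow hβ (show (-2 : ℝ) < -1 by norm_num)
    refine (h1.const_mul ((1 ^ α + 2 ^ α) * 2 ^ α * 3 ^ N)).mono'
      (measurable_weight_ofReal α β N).aestronglyMeasurable
      ((ae_restrict_iff' measurableSet_Ioo).mpr (.of_forall fun t ht => ?_))
    have n1 : ‖1 - (t : ℂ)‖ = 1 - t := by
      rw [← Complex.ofReal_one, ← Complex.ofReal_sub, Complex.norm_real,
        Real.norm_of_nonneg (by linarith [ht.2])]
    have n2 : ‖(t : ℂ) + 1‖ = -1 - t := by
      rw [← Complex.ofReal_one, ← Complex.ofReal_add, Complex.norm_real,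
        Real.norm_of_nonpos (by linarith [ht.2])]; ring
    have n3 : ‖(t : ℂ)‖ ≤ 2 := by
      rw [Complex.norm_real, Real.norm_eq_abs, abs_le]
      exact ⟨ht.1.le, by linarith [ht.2]⟩
    rw [Real.norm_of_nonneg (by positivity), deriv_ofReal, norm_one, mul_one, n1, n2]
    have h2 : (1 - t) ^ α ≤ (1 ^ α + 2 ^ α) * 2 ^ α :=
      Real.rpow_le_mul_rpow one_pos two_pos (by linarith [ht.2]) (by linarith [ht.1]) α
    have h3 : (1 + ‖(t : ℂ)‖) ^ N ≤ 3 ^ N := pow_le_pow_left₀ (by positivity) (by linarith) N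
    have p2 : 0 ≤ (-1 - t) ^ β := Real.rpow_nonneg (by linarith [ht.2]) _
    calc _ ≤ ((1 ^ α + 2 ^ α) * 2 ^ α) * (-1 - t) ^ β * 3 ^ N := by gcongr
      _ = _ := by ring

lemma exists_hasContourIntegral_Iio (hβ : -1 < β) (hα : α + β < -1) (hαβ : NotInt (α + β))
    (hW : IsWeightBranch α β (Iio (-1)) (fun t => (t : ℂ)) W) :
    ∃ c : ℂ, c ≠ 0 ∧ ∀ Q : ℂ[X], Q.natDegree + α + β < -1 →
      HasContourIntegral (Iio (-1)) (fun t => (t : ℂ))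
        (fun s => Q.eval (s : ℂ) * W s) (c * jacobiFunctional α β Q) := by
  have main : ∀ Q : ℂ[X], Q.natDegree + α + β < -1 →
      HasContourIntegral (Iio (-1)) (fun t => (t : ℂ))
        (fun s => Q.eval (s : ℂ) * W s) ((∫ s in Iio (-1), W s *
          deriv (fun t : ℝ => (t : ℂ)) s) * jacobiFunctional α β Q) := by
    intro Q hQ
    refine (isExhausted_Iio (-1)).hasContourIntegral (isPiecewiseC1_ofReal _) hW hαβ
      (integrableOn_weight_Iio hβ hQ) (eventually_lt_atBot (-1)) self_mem_nhdsWithin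
      (fun k hk => ?_) (fun k _ => ?_) le_rfl
    · have hk' : (k : ℝ) + 1 ≤ Q.natDegree := by exact_mod_cast hk
      have ht : Tendsto (fun s : ℝ => 1 + ‖(s : ℂ)‖) atBot atTop := by
        simp only [Complex.norm_real, Real.norm_eq_abs]
        exact tendsto_atTop_add_const_left _ _ tendsto_abs_atBot_atTop
      have h1 := ((tendsto_rpow_neg_atTop (y := -(α + 1 + (β + 1) + k)) (by linarith)).comp
        ht).const_mul ((1 / 3) ^ (β + 1) + 2 ^ (β + 1))
      rw [mul_zero] at h1
      refine squeeze_zero' (.of_forall fun s => by positivity) ?_ h1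
      filter_upwards [eventually_le_atBot (-2)] with s hs
      have hp : 0 < 1 + ‖(s : ℂ)‖ := by positivity
      simp only [Function.comp, neg_neg]
      rw [Real.rpow_add_natCast hp.ne', ← mul_assoc]
      exact mul_le_mul_of_nonneg_right (weight_ofReal_le_of_le_neg_two _ _ hs) (by positivity)
    · have z2 : (0 : ℝ) ^ (β + 1) = 0 := Real.zero_rpow (by linarith)
      have h1 : ContinuousAt (fun s : ℝ => ‖1 - (s : ℂ)‖ ^ (α + 1)) (-1) :=
        (by fun_prop : ContinuousAt (fun s : ℝ => ‖1 - (s : ℂ)‖) (-1)).rpow_const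
          (.inl (by norm_num))
      have h2 : ContinuousAt (fun s : ℝ => ‖(s : ℂ) + 1‖ ^ (β + 1)) (-1) :=
        (by fun_prop : ContinuousAt (fun s : ℝ => ‖(s : ℂ) + 1‖) (-1)).rpow_const
          (.inr (by linarith))
      have h3 : ContinuousAt (fun s : ℝ => ‖1 - (s : ℂ)‖ ^ (α + 1) * ‖(s : ℂ) + 1‖ ^ (β + 1) *
          (1 + ‖(s : ℂ)‖) ^ k) (-1) := (h1.mul h2).mul (by fun_prop)
      have := h3.tendsto.mono_left (nhdsWithin_le_nhds (s := Iio (-1)))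
      simpa [z2] using this
  refine ⟨_, ?_, main⟩
  -- Left of -1 the number t + 1 is negative; θ = πi supplies its constant argument.
  refine integral_ofReal_branch_ne_zero (isExhausted_Iio (-1)) (u := fun t => Real.log (1 - t))
    (v := fun t => Real.log (-1 - t)) (θ := Real.pi * Complex.I) ?_ ?_ ?_ ?_ hW
    (by simpa using (main 1 (by simpa using hα)).1)
  · exact ContinuousOn.log (by fun_prop) fun t (ht : t < -1) => (by linarith : 0 < 1 - t).ne'
  · exact ContinuousOn.log (by fun_prop) fun t (ht : t < -1) => (by linarith : 0 < -1 - t).ne'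
  · intro t (ht : t < -1)
    rw [← Complex.ofReal_exp, Real.exp_log (by linarith)]; push_cast; rfl
  · intro t (ht : t < -1)
    rw [Complex.exp_add, Complex.exp_pi_mul_I, ← Complex.ofReal_exp, Real.exp_log (by linarith)]
    push_cast; ring

lemma exists_hasContourIntegral_Ioi (hα : -1 < α) (hβ : α + β < -1) (hαβ : NotInt (α + β))
    (hW : IsWeightBranch α β (Ioi 1) (fun t => (t : ℂ)) W) :
    ∃ c : ℂ, c ≠ 0 ∧ ∀ Q : ℂ[X], Q.natDegree + α + β < -1 →
      HasContourIntegral (Ioi 1) (fun t => (t : ℂ))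
        (fun s => Q.eval (s : ℂ) * W s) (c * jacobiFunctional α β Q) := by
  have hW' : IsWeightBranch β α (Iio (-1)) (fun t => (t : ℂ)) fun s => W (-s) := by
    have hmaps : MapsTo (fun s : ℝ => -s) (Iio (-1)) (Ioi 1) := fun s (hs : s < -1) =>
      show (1 : ℝ) < -s by linarith
    refine ⟨hW.1.comp continuous_neg.continuousOn hmaps, fun s hs => ?_⟩
    have := hW.neg.2 (-s) (hmaps hs)
    simpa using this
  have hαβ' : NotInt (β + α) := by rwa [add_comm]
  obtain ⟨c, hc, H⟩ := exists_hasContourIntegral_Iio hα (by linarith) hαβ' hW'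
  refine ⟨c, hc, fun Q hQ => ?_⟩
  obtain ⟨h1, h2⟩ := H (Q.comp (-X)) (by
    rw [natDegree_comp, natDegree_neg, natDegree_X, mul_one]; linarith)
  rw [jacobiFunctional_comp_neg_X hαβ'] at h2
  have hpre : (fun s : ℝ => -s) ⁻¹' Ioi 1 = Iio (-1) := by
    ext s; simp only [mem_preimage, mem_Ioi, mem_Iio]; constructor <;> intro h <;> linarith
  have hmp := Measure.measurePreserving_neg (volume : Measure ℝ)
  have hemb := (MeasurableEquiv.neg ℝ).measurableEmbedding
  set F : ℝ → ℂ := fun s => Q.eval (s : ℂ) * W s * deriv (fun t : ℝ => (t : ℂ)) s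
  have e : (fun s : ℝ => (Q.comp (-X)).eval (s : ℂ) * W (-s) * deriv (fun t : ℝ => (t : ℂ)) s) =
      F ∘ fun s => -s := by
    funext s
    simp [F, deriv_ofReal]
  refine ⟨?_, ?_⟩
  · rw [e, ← hpre] at h1
    exact (hmp.integrableOn_comp_preimage hemb).mp h1
  · rw [← h2]
    have h3 := hmp.setIntegral_preimage_emb hemb F (Ioi 1)
    rw [hpre] at h3
    rw [← h3]
    exact congrArg (fun f : ℝ → ℂ => ∫ s in Iio (-1), f s) e.symm

end RealIntervals

/-! ### Polynomial division with degree bounds. -/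

section Division

lemma degree_mul_lt_of_lt {D S : ℂ[X]} {d m : ℕ} (hD : D.degree = d) (hS : S.degree < m) :
    (D * S).degree < (d + m : ℕ) := by
  rw [degree_mul, hD, Nat.cast_add]
  exact WithBot.add_lt_add_left (by simp) hS

lemma degree_lt_of_degree_mul_lt {D S : ℂ[X]} {d n : ℕ} (hD : D.degree = d)
    (h : (D * S).degree < n) : S.degree < (n - d : ℕ) := by
  by_cases hS : S = 0
  · rw [hS, degree_zero]; exact WithBot.bot_lt_coe _
  · rw [degree_mul, hD, degree_eq_natDegree hS] at h
    rw [degree_eq_natDegree hS]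
    norm_cast at h ⊢
    omega

lemma exists_eq_mul_add {D Q : ℂ[X]} {d n : ℕ} (hD : D.degree = d) (hQ : Q.degree < n)
    (hdn : d ≤ n) : ∃ S r : ℂ[X], Q = D * S + r ∧ r.degree < d ∧ S.degree < (n - d : ℕ) := by
  have hD0 : D ≠ 0 := by rintro rfl; simp at hD
  have hr : (Q % D).degree < d := hD ▸ degree_mod_lt Q hD0
  have e := EuclideanDomain.div_add_mod Q D
  refine ⟨Q / D, Q % D, e.symm, hr, degree_lt_of_degree_mul_lt hD ?_⟩
  have : D * (Q / D) = Q - Q % D := by rw [eq_sub_iff_add_eq]; exact e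
  rw [this]
  exact (degree_sub_le _ _).trans_lt (max_lt hQ (hr.trans_le (by exact_mod_cast hdn)))

lemma exists_eq_mul_add_mul_add {D₁ D₂ Q : ℂ[X]} {a b n : ℕ} (h₁ : D₁.degree = b)
    (h₂ : D₂.degree = a) (hco : IsCoprime D₁ D₂) (hQ : Q.degree < n) (hab : a + b ≤ n) :
    ∃ q₁ q₂ q₃ : ℂ[X], Q = D₁ * q₁ + D₂ * q₂ + D₁ * (D₂ * q₃) ∧ q₁.degree < a ∧ q₂.degree < b ∧
      q₃.degree < (n - a - b : ℕ) := by
  have hD0 : D₂ ≠ 0 := by rintro rfl; simp at h₂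
  obtain ⟨x, y, hxy⟩ := hco
  have e := EuclideanDomain.div_add_mod (x * Q) D₂
  -- By Bézout, x Q is the inverse of D₁ times Q modulo D₂, so Q - D₁ q₁ is divisible by D₂;
  -- dividing the quotient by D₁ yields q₂ and q₃.
  set q₁ := x * Q % D₂
  have hq₁ : q₁.degree < a := h₂ ▸ degree_mod_lt _ hD0
  have hS : D₂ * (y * Q + D₁ * (x * Q / D₂)) = Q - D₁ * q₁ := by
    linear_combination D₁ * e + Q * hxy
  have hdeg : (D₂ * (y * Q + D₁ * (x * Q / D₂))).degree < n := by
    rw [hS]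
    refine (degree_sub_le _ _).trans_lt (max_lt hQ ((degree_mul_lt_of_lt h₁ hq₁).trans_le ?_))
    exact_mod_cast (by omega : b + a ≤ n)
  obtain ⟨q₃, q₂, h3, h4, h5⟩ := exists_eq_mul_add h₁ (degree_lt_of_degree_mul_lt h₂ hdeg)
    (by omega)
  refine ⟨q₁, q₂, q₃, ?_, hq₁, h4, h5⟩
  rw [h3] at hS
  linear_combination -hS

lemma degree_one_add_X_pow (b : ℕ) : (((1 : ℂ[X]) + X) ^ b).degree = (b : WithBot ℕ) := by
  rw [degree_pow, add_comm, ← C_1, degree_X_add_C]; simp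

lemma degree_one_sub_X_pow (a : ℕ) : (((1 : ℂ[X]) - X) ^ a).degree = (a : WithBot ℕ) := by
  rw [degree_pow, ← degree_neg, neg_sub, ← C_1, degree_X_sub_C]; simp

lemma isCoprime_one_add_X_pow (a b : ℕ) : IsCoprime (((1 : ℂ[X]) + X) ^ b) ((1 - X) ^ a) := by
  refine IsCoprime.pow ⟨C (1 / 2), C (1 / 2), ?_⟩
  rw [← mul_add, show (1 : ℂ[X]) + X + (1 - X) = C 2 by
    rw [show (2 : ℂ) = 1 + 1 by norm_num, C_add, C_1]; ring, ← C_mul]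
  norm_num

end Division

/-! ### Three families of conditions combined into one. -/

section Functionals

variable {n : ℕ} {p : ℂ[X]} (L : ℂ[X] →ₗ[ℂ] ℂ)

lemma orthogonal_iff_of_coprime {D₁ D₂ : ℂ[X]} {a b : ℕ} (h₁ : D₁.degree = b) (h₂ : D₂.degree = a)
    (hco : IsCoprime D₁ D₂) (hab : a + b ≤ n) :
    ((∀ q : ℂ[X], q.degree < a → L (D₁ * (q * p)) = 0) ∧
      (∀ q : ℂ[X], q.degree < b → L (D₂ * (q * p)) = 0) ∧
      (∀ q : ℂ[X], q.degree < (n - a - b : ℕ) → L (D₁ * (D₂ * (q * p))) = 0)) ↔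
    ∀ Q : ℂ[X], Q.degree < n → L (p * Q) = 0 := by
  constructor
  · rintro ⟨c1, c2, c3⟩ Q hQ
    obtain ⟨q₁, q₂, q₃, rfl, d1, d2, d3⟩ := exists_eq_mul_add_mul_add h₁ h₂ hco hQ hab
    have : p * (D₁ * q₁ + D₂ * q₂ + D₁ * (D₂ * q₃)) =
        D₁ * (q₁ * p) + D₂ * (q₂ * p) + D₁ * (D₂ * (q₃ * p)) := by ring
    rw [this, map_add, map_add, c1 _ d1, c2 _ d2, c3 _ d3]; simp
  · intro h
    refine ⟨fun q hq => ?_, fun q hq => ?_, fun q hq => ?_⟩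
    · rw [show D₁ * (q * p) = p * (D₁ * q) by ring]
      exact h _ ((degree_mul_lt_of_lt h₁ hq).trans_le (by exact_mod_cast (by omega : b + a ≤ n)))
    · rw [show D₂ * (q * p) = p * (D₂ * q) by ring]
      exact h _ ((degree_mul_lt_of_lt h₂ hq).trans_le (by exact_mod_cast hab))
    · rw [show D₁ * (D₂ * (q * p)) = p * (D₁ * (D₂ * q)) by ring]
      exact h _ ((degree_mul_lt_of_lt h₁ (degree_mul_lt_of_lt h₂ hq)).trans_le
        (by exact_mod_cast (by omega : b + (a + (n - a - b)) ≤ n)))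

/-- Divide Q by D, then the quotient by X^m. Any polynomial of degree m would serve in place of X^m.
-/
lemma orthogonal_iff_of_nested {D : ℂ[X]} {b m : ℕ} (hD : D.degree = b) (hbm : b + m ≤ n) :
    ((∀ q : ℂ[X], q.degree < m → L (D * (q * p)) = 0) ∧
      (∀ q : ℂ[X], q.degree < b → L (q * p) = 0) ∧
      (∀ q : ℂ[X], q.degree < (n - b - m : ℕ) → L (D * (X ^ m * (q * p))) = 0)) ↔
    ∀ Q : ℂ[X], Q.degree < n → L (p * Q) = 0 := by
  have hX : ((X : ℂ[X]) ^ m).degree = (m : WithBot ℕ) := degree_X_pow m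
  constructor
  · rintro ⟨c1, c2, c3⟩ Q hQ
    obtain ⟨S, q₂, rfl, d2, dS⟩ := exists_eq_mul_add hD hQ (by omega)
    obtain ⟨q₃, q₁, rfl, d1, d3⟩ := exists_eq_mul_add hX dS (by omega)
    have : p * (D * (X ^ m * q₃ + q₁) + q₂) =
        D * (X ^ m * (q₃ * p)) + D * (q₁ * p) + q₂ * p := by ring
    rw [this, map_add, map_add, c1 _ d1, c2 _ d2, c3 _ d3]; simp
  · intro h
    refine ⟨fun q hq => ?_, fun q hq => ?_, fun q hq => ?_⟩
    · rw [show D * (q * p) = p * (D * q) by ring]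
      exact h _ ((degree_mul_lt_of_lt hD hq).trans_le (by exact_mod_cast hbm))
    · rw [mul_comm]
      exact h _ (hq.trans_le (by exact_mod_cast (by omega : b ≤ n)))
    · rw [show D * (X ^ m * (q * p)) = p * (D * (X ^ m * q)) by ring]
      exact h _ ((degree_mul_lt_of_lt hD (degree_mul_lt_of_lt hX hq)).trans_le
        (by exact_mod_cast (by omega : b + (m + (n - b - m)) ≤ n)))

end Functionals

/-! ### From contour conditions to conditions on the functional. -/

lemma mem_polyDegLE_iff {m : ℤ} {k : ℕ} (hm : m = k - 1) {q : ℂ[X]} :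
    q ∈ polyDegLE m ↔ q.degree < k := by
  change q = 0 ∨ (q.natDegree : ℤ) ≤ m ↔ _
  by_cases hq : q = 0
  · simp [hq]
  · rw [degree_eq_natDegree hq]
    simp only [hq, false_or]
    norm_cast
    omega

lemma degree_eq_of_mem_polyDegEq {m : ℤ} {k : ℕ} (hm : m = k) {q : ℂ[X]} (h : q ∈ polyDegEq m) :
    q.degree = k := by
  obtain ⟨h0, h1⟩ : q ≠ 0 ∧ (q.natDegree : ℤ) = m := h
  rw [degree_eq_natDegree h0]
  have : q.natDegree = k := by omega
  rw [this]

lemma natDegree_mul_le_of_degree_lt {q p : ℂ[X]} {k n : ℕ} (hq : q.degree < k)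
    (hp : p.natDegree ≤ n) : q * p = 0 ∨ (q * p).natDegree + 1 ≤ k + n := by
  by_cases h : q = 0
  · simp [h]
  · right
    have h1 := (natDegree_lt_iff_degree_lt h).mpr hq
    have h2 : (q * p).natDegree ≤ _ := natDegree_mul_le
    omega

lemma orthTo_iff {I : Set ℝ} {γ W : ℝ → ℂ} {p : ℂ[X]} {m : ℤ} {k : ℕ} (hm : m = k - 1)
    {Λ : ℂ[X] → ℂ} {c : ℂ} (hc : c ≠ 0)
    (H : ∀ q : ℂ[X], q.degree < k →
      HasContourIntegral I γ (fun s => q.eval (γ s) * p.eval (γ s) * W s) (c * Λ q)) :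
    OrthTo I γ W p m ↔ ∀ q : ℂ[X], q.degree < k → Λ q = 0 := by
  constructor
  · intro h q hq
    have h1 := (h q ((mem_polyDegLE_iff hm).mpr hq)).2
    rw [(H q hq).2] at h1
    exact (mul_eq_zero.mp h1).resolve_left hc
  · intro h q hq
    have hq' := (mem_polyDegLE_iff hm).mp hq
    have := H q hq'
    rwa [h q hq', mul_zero] at this

lemma characterizesUpToConst_jacobiP {n : ℕ} {α β : ℝ} (hα : NotInt α) (hβ : NotInt β)
    (hαβ : NotInt (α + β)) {conds : ℂ[X] → Prop}
    (h : ∀ p : ℂ[X], p.natDegree ≤ n → (conds p ↔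
      ∀ Q : ℂ[X], Q.degree < n → jacobiFunctional α β (p * Q) = 0)) :
    CharacterizesUpToConst n (jacobiP n α β) conds := by
  refine ⟨fun h0 => coeff_jacobiP_ne_zero n hαβ (by rw [h0, coeff_zero]),
    natDegree_jacobiP n hαβ, fun p => ⟨?_, ?_⟩⟩
  · rintro ⟨hp, hcond⟩
    exact eq_C_mul_jacobiP_of_orthogonal hαβ hα hβ hp ((h p hp).mp hcond)
  · rintro ⟨c, rfl⟩
    have hp : (C c * jacobiP n α β).natDegree ≤ n :=
      (natDegree_C_mul_le _ _).trans (natDegree_jacobiP_le n α β)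
    refine ⟨hp, (h _ hp).mpr fun Q hQ => ?_⟩
    rw [mul_assoc, ← smul_eq_C_mul, map_smul, jacobiFunctional_jacobiP_mul_eq_zero hαβ hα hβ hQ,
      smul_zero]

/-- D is the factor absorbed from the weight; its degree is such that D q has degree exactly n, the
first at which the functional cannot vanish. -/
lemma nonzeroAgainst_jacobiP {n : ℕ} {α β : ℝ} (hα : NotInt α) (hβ : NotInt β)
    (hαβ : NotInt (α + β)) {I : Set ℝ} {γ W : ℝ → ℂ} {m : ℤ} {k : ℕ} (hm : m = k) {D : ℂ[X]}
    (hD : D.degree = (n - k : ℕ)) (hk : k ≤ n) {c : ℂ} (hc : c ≠ 0)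
    (H : ∀ q : ℂ[X],
      HasContourIntegral I γ (fun s => q.eval (γ s) * (jacobiP n α β).eval (γ s) * W s)
        (c * jacobiFunctional α β (D * (q * jacobiP n α β)))) :
    NonzeroAgainst I γ W (jacobiP n α β) m := by
  intro q hq
  refine ⟨_, mul_ne_zero hc ?_, H q⟩
  rw [show D * (q * jacobiP n α β) = jacobiP n α β * (D * q) by ring]
  refine jacobiFunctional_jacobiP_mul_ne_zero hαβ hα hβ ?_
  rw [degree_mul, hD, degree_eq_of_mem_polyDegEq hm hq]
  exact_mod_cast (by omega : n - k + k = n)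

/-- Rewrites an integration formula for the shifted weight in terms of the unshifted functional.
`Dom` is the class of polynomials for which the integral converges. -/
lemma exists_mul_one_add_X_pow {α β : ℝ} (hαβ : NotInt (α + β)) (hβ : NotInt β) (b : ℕ)
    {Dom : ℂ[X] → Prop} {F : ℂ[X] → ℂ → Prop}
    (h : ∃ c : ℂ, c ≠ 0 ∧ ∀ Q, Dom Q → F Q (c * jacobiFunctional α (β + b) Q)) :
    ∃ c : ℂ, c ≠ 0 ∧ ∀ Q, Dom Q → F Q (c * jacobiFunctional α β ((1 + X) ^ b * Q)) := by
  obtain ⟨c, hc, H⟩ := h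
  obtain ⟨d, hd, H'⟩ := jacobiFunctional_one_add_X_pow_mul hαβ hβ b
  refine ⟨c / d, div_ne_zero hc hd, fun Q hQ => ?_⟩
  rw [H', ← mul_assoc, div_mul_cancel₀ _ hd]
  exact H Q hQ

lemma exists_mul_one_sub_X_pow {α β : ℝ} (hαβ : NotInt (α + β)) (hα : NotInt α) (a : ℕ)
    {Dom : ℂ[X] → Prop} {F : ℂ[X] → ℂ → Prop}
    (h : ∃ c : ℂ, c ≠ 0 ∧ ∀ Q, Dom Q → F Q (c * jacobiFunctional (α + a) β Q)) :
    ∃ c : ℂ, c ≠ 0 ∧ ∀ Q, Dom Q → F Q (c * jacobiFunctional α β ((1 - X) ^ a * Q)) := by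
  obtain ⟨c, hc, H⟩ := h
  obtain ⟨d, hd, H'⟩ := jacobiFunctional_one_sub_X_pow_mul hαβ hα a
  refine ⟨c / d, div_ne_zero hc hd, fun Q hQ => ?_⟩
  rw [H', ← mul_assoc, div_mul_cancel₀ _ hd]
  exact H Q hQ

lemma HasContourIntegral.eval_mul {I : Set ℝ} (hI : MeasurableSet I) {γ W : ℝ → ℂ} {p q : ℂ[X]}
    {v : ℂ} (h : HasContourIntegral I γ (fun s => (q * p).eval (γ s) * W s) v) :
    HasContourIntegral I γ (fun s => q.eval (γ s) * p.eval (γ s) * W s) v :=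
  h.congr hI fun s _ => by rw [Polynomial.eval_mul]

lemma HasContourIntegral.eval_X_pow_mul {I : Set ℝ} (hI : MeasurableSet I) {γ W : ℝ → ℂ}
    {p q : ℂ[X]} {v : ℂ} {m : ℕ} {k : ℤ} (hk : k = m)
    (h : HasContourIntegral I γ (fun s => (X ^ m * (q * p)).eval (γ s) * W s) v) :
    HasContourIntegral I γ (fun s => q.eval (γ s) * p.eval (γ s) * (γ s ^ k * W s)) v :=
  h.congr hI fun s _ => by
    rw [hk, zpow_natCast, Polynomial.eval_mul, Polynomial.eval_mul, eval_pow, eval_X]; ring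

/-- The upper inequality is strict because x is not an integer; the convergence bounds in the second
and third regimes rely on it. -/
lemma NotInt.floor_neg_spec {x : ℝ} (h : NotInt x) (hx : x < 0) :
    ∃ a : ℕ, ⌊-x⌋ = a ∧ x + a < 0 ∧ -1 < x + a := by
  obtain ⟨a, ha⟩ := Int.eq_ofNat_of_zero_le (Int.floor_nonneg.mpr (by linarith : 0 ≤ -x))
  have h1 := Int.floor_le (-x)
  have h2 := Int.lt_floor_add_one (-x)
  rw [ha, Int.cast_natCast] at h1 h2
  refine ⟨a, ha, lt_of_le_of_ne (by linarith) fun e => ?_, by linarith⟩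
  exact h (-a) (by push_cast; linarith)

/-! ### The three regimes. -/

section Regimes

variable {n a b : ℕ} {α β : ℝ}

lemma jacobiP_first_regime (hα : NotInt α) (hβ : NotInt β) (hαβ : NotInt (α + β))
    (ha' : -1 < α + a) (hb' : -1 < β + b) (hab : a + b ≤ n)
    {γ₁ γ₂ W₁ W₂ W₃ : ℝ → ℂ} (hγ₁ : IsGammaNegOne γ₁) (hγ₂ : IsGammaOne γ₂)
    (hW₁ : IsWeightBranch α (β + b) (Ioo 0 1) γ₁ W₁)
    (hW₂ : IsWeightBranch (α + a) β (Ioo 0 1) γ₂ W₂)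
    (hW₃ : IsWeightBranch (α + a) (β + b) (Ioo (-1) 1) (fun t => (t : ℂ)) W₃) :
    CharacterizesUpToConst n (jacobiP n α β) (fun p =>
      OrthTo (Ioo 0 1) γ₁ W₁ p (a - 1) ∧ OrthTo (Ioo 0 1) γ₂ W₂ p (b - 1) ∧
      OrthTo (Ioo (-1) 1) (fun t => (t : ℂ)) W₃ p (n - a - b - 1)) ∧
    NonzeroAgainst (Ioo (-1) 1) (fun t => (t : ℂ)) W₃ (jacobiP n α β) (n - a - b) := by
  have s1 : NotInt (α + (β + b)) := by rw [← add_assoc]; exact hαβ.add_natCast b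
  have s2 : NotInt (α + a + β) := by rw [add_right_comm]; exact hαβ.add_natCast a
  have s3 : NotInt (α + a + (β + b)) := by rw [← add_assoc]; exact s2.add_natCast b
  obtain ⟨c₁, hc₁, H₁⟩ := exists_mul_one_add_X_pow hαβ hβ b (Dom := fun _ => True)
    ((hγ₁.hasContourIntegral hα s1 hb' hW₁).imp fun c h => ⟨h.1, fun Q _ => h.2 Q⟩)
  obtain ⟨c₂, hc₂, H₂⟩ := exists_mul_one_sub_X_pow hαβ hα a (Dom := fun _ => True)
    ((hγ₂.hasContourIntegral s2 hβ ha' hW₂).imp fun c h => ⟨h.1, fun Q _ => h.2 Q⟩)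
  obtain ⟨c₃, hc₃, H₃⟩ := exists_mul_one_add_X_pow s2 hβ b (Dom := fun _ => True)
    ((exists_hasContourIntegral_Ioo ha' hb' s3 hW₃).imp fun c h => ⟨h.1, fun Q _ => h.2 Q⟩)
  obtain ⟨c₄, hc₄, H₄⟩ := jacobiFunctional_one_sub_X_pow_mul hαβ hα a
  have H₃' : ∀ p q : ℂ[X], HasContourIntegral (Ioo (-1) 1) (fun t => (t : ℂ))
      (fun s => q.eval (s : ℂ) * p.eval (s : ℂ) * W₃ s)
        (c₃ / c₄ * jacobiFunctional α β ((1 + X) ^ b * ((1 - X) ^ a * (q * p)))) := fun p q => by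
    have := HasContourIntegral.eval_mul measurableSet_Ioo (H₃ (q * p) trivial)
    rwa [mul_left_comm, H₄, ← mul_assoc, div_mul_cancel₀ _ hc₄]
  refine ⟨characterizesUpToConst_jacobiP hα hβ hαβ fun p hp => ?_, ?_⟩
  · rw [← orthogonal_iff_of_coprime _ (degree_one_add_X_pow b) (degree_one_sub_X_pow a)
      (isCoprime_one_add_X_pow a b) hab]
    exact and_congr
      (orthTo_iff rfl hc₁ fun q _ => .eval_mul measurableSet_Ioo (H₁ (q * p) trivial))
      (and_congr (orthTo_iff rfl hc₂ fun q _ => .eval_mul measurableSet_Ioo (H₂ (q * p) trivial))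
        (orthTo_iff (by omega) (div_ne_zero hc₃ hc₄) fun q _ => H₃' p q))
  · refine nonzeroAgainst_jacobiP hα hβ hαβ (k := n - a - b) (by omega)
      (D := (1 + X) ^ b * (1 - X) ^ a) ?_ (by omega) (div_ne_zero hc₃ hc₄) fun q => ?_
    · rw [degree_mul, degree_one_add_X_pow, degree_one_sub_X_pow]
      exact_mod_cast (by omega : b + a = n - (n - a - b))
    · rw [mul_assoc]; exact H₃' _ q

lemma jacobiP_second_regime (hα : NotInt α) (hβ : NotInt β) (hαβ : NotInt (α + β))
    (ha : α + a < 0) (hb : β + b < 0) (hb' : -1 < β + b) (hα1 : α < -1) (hβ1 : β < -1)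
    (hαn : α + n < 0) (hna : n ≤ a) (hab : a + b ≤ 2 * n)
    {γ₁ γ₂ W₁ W₂ W₃ : ℝ → ℂ} (hγ₁ : IsGammaInfty γ₁) (hγ₂ : IsGammaNegOne γ₂)
    (hW₁ : IsWeightBranch α β univ γ₁ W₁)
    (hW₂ : IsWeightBranch α (β + b) (Ioo 0 1) γ₂ W₂)
    (hW₃ : IsWeightBranch α (β + b) (Iio (-1)) (fun t => (t : ℂ)) W₃) :
    CharacterizesUpToConst n (jacobiP n α β) (fun p =>
      OrthTo (Iio (-1)) (fun t => (t : ℂ)) W₃ p (a - n - 1) ∧ OrthTo univ γ₁ W₁ p (b - 1) ∧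
      OrthTo (Ioo 0 1) γ₂ (fun s => γ₂ s ^ (-n + a : ℤ) * W₂ s) p (2 * n - a - b - 1)) ∧
    NonzeroAgainst (Ioo 0 1) γ₂ (fun s => γ₂ s ^ (-n + a : ℤ) * W₂ s) (jacobiP n α β)
      (2 * n - a - b) := by
  have s1 : NotInt (α + (β + b)) := by rw [← add_assoc]; exact hαβ.add_natCast b
  have hX : ((X : ℂ[X]) ^ (a - n)).degree = (a - n : ℕ) := degree_X_pow _
  obtain ⟨c₁, hc₁, H₁⟩ := exists_mul_one_add_X_pow hαβ hβ b
    (exists_hasContourIntegral_Iio hb' (by linarith) s1 hW₃)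
  have H₂ : ∀ Q : ℂ[X], Q.natDegree + α + β < -1 → _ := fun Q hQ =>
    hγ₁.hasContourIntegral_of_degree hαβ hW₁ hQ
  have hc₂ := hγ₁.integral_ne_zero hα hβ hαβ (by linarith) hW₁
  obtain ⟨c₃, hc₃, H₃⟩ := exists_mul_one_add_X_pow hαβ hβ b (Dom := fun _ => True)
    ((hγ₂.hasContourIntegral hα s1 hb' hW₂).imp fun c h => ⟨h.1, fun Q _ => h.2 Q⟩)
  refine ⟨characterizesUpToConst_jacobiP hα hβ hαβ fun p hp => ?_, ?_⟩
  · rw [← orthogonal_iff_of_nested _ (degree_one_add_X_pow b) (m := a - n) (by omega)]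
    refine and_congr (orthTo_iff (by omega) hc₁ fun q hq => .eval_mul measurableSet_Iio
      (H₁ (q * p) ?_)) (and_congr (orthTo_iff rfl hc₂ fun q hq => .eval_mul MeasurableSet.univ
        (H₂ (q * p) ?_)) (orthTo_iff (by omega) hc₃ fun q _ =>
          .eval_X_pow_mul measurableSet_Ioo (by omega) (H₃ (X ^ (a - n) * (q * p)) trivial)))
    -- Here deg(q p) ≤ a - 1, and α + a < 0, β + b < 0 give convergence at infinity.
    · rcases natDegree_mul_le_of_degree_lt hq hp with h | h
      · rw [h]; simp; linarith
      · rw [Nat.sub_add_cancel hna] at h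
        have : ((q * p).natDegree : ℝ) + 1 ≤ a := by exact_mod_cast h
        linarith
    -- Here deg(q p) ≤ b + n - 1, and convergence uses β + b < 0 and α + n < 0.
    · rcases natDegree_mul_le_of_degree_lt hq hp with h | h
      · rw [h]; simp; linarith
      · have : ((q * p).natDegree : ℝ) + 1 ≤ b + n := by exact_mod_cast h
        linarith
  · refine nonzeroAgainst_jacobiP hα hβ hαβ (k := 2 * n - a - b) (by omega)
      (D := (1 + X) ^ b * X ^ (a - n)) ?_ (by omega) hc₃ fun q =>
        .eval_X_pow_mul measurableSet_Ioo (by omega) (m := a - n) ?_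
    · rw [degree_mul, degree_one_add_X_pow, hX]
      exact_mod_cast (by omega : b + (a - n) = n - (2 * n - a - b))
    · rw [mul_assoc]; exact H₃ _ trivial

lemma jacobiP_third_regime (hα : NotInt α) (hβ : NotInt β) (hαβ : NotInt (α + β))
    (ha : α + a < 0) (ha' : -1 < α + a) (hb : β + b < 0) (hα1 : α < -1) (hβ1 : β < -1)
    (hβn : β + n < 0) (hnb : n ≤ b) (hab : a + b ≤ 2 * n)
    {γ₁ γ₂ W₁ W₂ W₃ : ℝ → ℂ} (hγ₁ : IsGammaInfty γ₁) (hγ₂ : IsGammaOne γ₂)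
    (hW₁ : IsWeightBranch α β univ γ₁ W₁)
    (hW₂ : IsWeightBranch (α + a) β (Ioo 0 1) γ₂ W₂)
    (hW₃ : IsWeightBranch (α + a) β (Ioi 1) (fun t => (t : ℂ)) W₃) :
    CharacterizesUpToConst n (jacobiP n α β) (fun p =>
      OrthTo (Ioi 1) (fun t => (t : ℂ)) W₃ p (b - n - 1) ∧ OrthTo univ γ₁ W₁ p (a - 1) ∧
      OrthTo (Ioo 0 1) γ₂ (fun s => γ₂ s ^ (-n + b : ℤ) * W₂ s) p (2 * n - a - b - 1)) ∧
    NonzeroAgainst (Ioo 0 1) γ₂ (fun s => γ₂ s ^ (-n + b : ℤ) * W₂ s) (jacobiP n α β)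
      (2 * n - a - b) := by
  have s2 : NotInt (α + a + β) := by rw [add_right_comm]; exact hαβ.add_natCast a
  have hX : ((X : ℂ[X]) ^ (b - n)).degree = (b - n : ℕ) := degree_X_pow _
  obtain ⟨c₁, hc₁, H₁⟩ := exists_mul_one_sub_X_pow hαβ hα a
    (exists_hasContourIntegral_Ioi ha' (by linarith) s2 hW₃)
  have H₂ : ∀ Q : ℂ[X], Q.natDegree + α + β < -1 → _ := fun Q hQ =>
    hγ₁.hasContourIntegral_of_degree hαβ hW₁ hQ
  have hc₂ := hγ₁.integral_ne_zero hα hβ hαβ (by linarith) hW₁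
  obtain ⟨c₃, hc₃, H₃⟩ := exists_mul_one_sub_X_pow hαβ hα a (Dom := fun _ => True)
    ((hγ₂.hasContourIntegral s2 hβ ha' hW₂).imp fun c h => ⟨h.1, fun Q _ => h.2 Q⟩)
  refine ⟨characterizesUpToConst_jacobiP hα hβ hαβ fun p hp => ?_, ?_⟩
  · rw [← orthogonal_iff_of_nested _ (degree_one_sub_X_pow a) (m := b - n) (by omega)]
    refine and_congr (orthTo_iff (by omega) hc₁ fun q hq => .eval_mul measurableSet_Ioi
      (H₁ (q * p) ?_)) (and_congr (orthTo_iff rfl hc₂ fun q hq => .eval_mul MeasurableSet.univ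
        (H₂ (q * p) ?_)) (orthTo_iff (by omega) hc₃ fun q _ =>
          .eval_X_pow_mul measurableSet_Ioo (by omega) (H₃ (X ^ (b - n) * (q * p)) trivial)))
    · rcases natDegree_mul_le_of_degree_lt hq hp with h | h
      · rw [h]; simp; linarith
      · rw [Nat.sub_add_cancel hnb] at h
        have : ((q * p).natDegree : ℝ) + 1 ≤ b := by exact_mod_cast h
        linarith
    · rcases natDegree_mul_le_of_degree_lt hq hp with h | h
      · rw [h]; simp; linarith
      · have : ((q * p).natDegree : ℝ) + 1 ≤ a + n := by exact_mod_cast h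
        linarith
  · refine nonzeroAgainst_jacobiP hα hβ hαβ (k := 2 * n - a - b) (by omega)
      (D := (1 - X) ^ a * X ^ (b - n)) ?_ (by omega) hc₃ fun q =>
        .eval_X_pow_mul measurableSet_Ioo (by omega) (m := b - n) ?_
    · rw [degree_mul, degree_one_sub_X_pow, hX]
      exact_mod_cast (by omega : a + (b - n) = n - (2 * n - a - b))
    · rw [mul_assoc]; exact H₃ _ trivial

end Regimes

end

theorem theorem6p3 (n : ℕ) (α β : ℝ)
    (hα : ∀ k : ℤ, α ≠ k) (hβ : ∀ k : ℤ, β ≠ k) (hαβ : ∀ k : ℤ, α + β ≠ k)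
    (hα1 : α < -1) (hβ1 : β < -1) (hn : 0 < 2 * (n : ℝ) + α + β) :
    -- first regime
    (-1 < α + β + n →
      ∀ γ₁ γ₂ W₁ W₂ W₃ : ℝ → ℂ, IsGammaNegOne γ₁ → IsGammaOne γ₂ →
        IsWeightBranch α (β + ⌊-β⌋) (Ioo 0 1) γ₁ W₁ →
        IsWeightBranch (α + ⌊-α⌋) β (Ioo 0 1) γ₂ W₂ →
        IsWeightBranch (α + ⌊-α⌋) (β + ⌊-β⌋) (Ioo (-1) 1) (fun t => (t : ℂ)) W₃ →
        CharacterizesUpToConst n (jacobiP n α β) (fun p =>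
          OrthTo (Ioo 0 1) γ₁ W₁ p (⌊-α⌋ - 1) ∧
          OrthTo (Ioo 0 1) γ₂ W₂ p (⌊-β⌋ - 1) ∧
          OrthTo (Ioo (-1) 1) (fun t => (t : ℂ)) W₃ p (n - ⌊-α⌋ - ⌊-β⌋ - 1)) ∧
        NonzeroAgainst (Ioo (-1) 1) (fun t => (t : ℂ)) W₃ (jacobiP n α β)
          (n - ⌊-α⌋ - ⌊-β⌋)) ∧
    -- second regime
    (α < -n →
      ∀ γ₁ γ₂ W₁ W₂ W₃ : ℝ → ℂ, IsGammaInfty γ₁ → IsGammaNegOne γ₂ →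
        IsWeightBranch α β univ γ₁ W₁ →
        IsWeightBranch α (β + ⌊-β⌋) (Ioo 0 1) γ₂ W₂ →
        IsWeightBranch α (β + ⌊-β⌋) (Iio (-1)) (fun t => (t : ℂ)) W₃ →
        CharacterizesUpToConst n (jacobiP n α β) (fun p =>
          OrthTo (Iio (-1)) (fun t => (t : ℂ)) W₃ p (⌊-α⌋ - n - 1) ∧
          OrthTo univ γ₁ W₁ p (⌊-β⌋ - 1) ∧
          OrthTo (Ioo 0 1) γ₂ (fun s => γ₂ s ^ (-n + ⌊-α⌋) * W₂ s) p
            (2 * n - ⌊-α⌋ - ⌊-β⌋ - 1)) ∧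
        NonzeroAgainst (Ioo 0 1) γ₂ (fun s => γ₂ s ^ (-n + ⌊-α⌋) * W₂ s) (jacobiP n α β)
          (2 * n - ⌊-α⌋ - ⌊-β⌋)) ∧
    -- third regime
    (β < -n →
      ∀ γ₁ γ₂ W₁ W₂ W₃ : ℝ → ℂ, IsGammaInfty γ₁ → IsGammaOne γ₂ →
        IsWeightBranch α β univ γ₁ W₁ →
        IsWeightBranch (α + ⌊-α⌋) β (Ioo 0 1) γ₂ W₂ →
        IsWeightBranch (α + ⌊-α⌋) β (Ioi 1) (fun t => (t : ℂ)) W₃ →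
        CharacterizesUpToConst n (jacobiP n α β) (fun p =>
          OrthTo (Ioi 1) (fun t => (t : ℂ)) W₃ p (⌊-β⌋ - n - 1) ∧
          OrthTo univ γ₁ W₁ p (⌊-α⌋ - 1) ∧
          OrthTo (Ioo 0 1) γ₂ (fun s => γ₂ s ^ (-n + ⌊-β⌋) * W₂ s) p
            (2 * n - ⌊-α⌋ - ⌊-β⌋ - 1)) ∧
        NonzeroAgainst (Ioo 0 1) γ₂ (fun s => γ₂ s ^ (-n + ⌊-β⌋) * W₂ s) (jacobiP n α β)
          (2 * n - ⌊-α⌋ - ⌊-β⌋)) := by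
  obtain ⟨a, ha, ha0, ha1⟩ := NotInt.floor_neg_spec hα (by linarith)
  obtain ⟨b, hb, hb0, hb1⟩ := NotInt.floor_neg_spec hβ (by linarith)
  simp only [ha, hb, Int.cast_natCast]
  -- The assumption 2n + α + β > 0 enters here: it keeps the degree 2n - a - b nonnegative in the
  -- last two regimes.
  have hab : a + b ≤ 2 * n := by
    have : (a : ℝ) + b < 2 * n := by linarith
    exact_mod_cast this.le
  refine ⟨fun h γ₁ γ₂ W₁ W₂ W₃ hγ₁ hγ₂ hW₁ hW₂ hW₃ => ?_,
    fun h γ₁ γ₂ W₁ W₂ W₃ hγ₁ hγ₂ hW₁ hW₂ hW₃ => ?_,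
    fun h γ₁ γ₂ W₁ W₂ W₃ hγ₁ hγ₂ hW₁ hW₂ hW₃ => ?_⟩
  -- From a + b < -α - β < n + 1, so the three families have a + b + (n - a - b) = n conditions in
  -- total.
  · have hle : a + b ≤ n := by
      have : (a : ℝ) + b < n + 1 := by linarith
      exact Nat.lt_succ_iff.mp (by exact_mod_cast this)
    exact jacobiP_first_regime hα hβ hαβ ha1 hb1 hle hγ₁ hγ₂ hW₁ hW₂ hW₃
  · have hle : n ≤ a := by
      have : (n : ℝ) < a + 1 := by linarith
      exact Nat.lt_succ_iff.mp (by exact_mod_cast this)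
    exact jacobiP_second_regime hα hβ hαβ ha0 hb0 hb1 hα1 hβ1 (by linarith) hle hab hγ₁ hγ₂
      hW₁ hW₂ hW₃
  · have hle : n ≤ b := by
      have : (n : ℝ) < b + 1 := by linarith
      exact Nat.lt_succ_iff.mp (by exact_mod_cast this)
    exact jacobiP_third_regime hα hβ hαβ ha0 ha1 hb0 hα1 hβ1 (by linarith) hle hab hγ₁ hγ₂
      hW₁ hW₂ hW₃
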